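/- Let $A,B$ be finite-dimensional quantum systems and $\log$ the logarithm to base $2$. Let $\mathrm{SEP}(A;B)$ be the set of separable states, i.e. finite convex combinations $\sum_i p_i\,\rho_A^{(i)}\otimes\sigma_B^{(i)}$ of products of density operators. For a Hermitian operator $\omega$ on $AB$ let $$\gamma_{\mathrm{SEP}}(\omega)=\inf\Big\{\sum_{i=1}^m|a_i| \;\Big|\; \omega=\sum_{i=1}^m a_i\tau_i,\ m\ge 1,\ \tau_i\in\mathrm{SEP}(A;B),\ a_i\in\mathbb R\Big\}$$ (with $\inf\emptyset=\infty$), and for a density operator $\rho$ and $\epsilon\ge 0$ let $\gamma^{\epsilon}_{\mathrm{SEP}}(\rho)=\inf\{\gamma_{\mathrm{SEP}}(\sigma) \mid \sigma \text{ a density operator},\ \tfrac12\|\rho-\sigma\|_1\le\epsilon\}$. Regard $\rho^{\otimes n}$ as a bipartite state across the cut $A^n;B^n$, and define the regularized and the asymptotic quasiprobability extent $$\gamma^{\mathrm{reg}}_{\mathrm{SEP}}(\rho)=\lim_{n\to\infty}\gamma_{\mathrm{SEP}}(\rho^{\otimes n})^{1/n},\qquad \tilde\gamma^{\mathrm{reg}}_{\mathrm{SEP}}(\rho)=\lim_{\epsilon\to0^+}\liminf_{n\to\infty}\gamma^{\epsilon}_{\mathrm{SEP}}(\rho^{\otimes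 n})^{1/n}.$$ Let $\rho_{AB}=|\psi\rangle\langle\psi|$ be a pure state on $AB$ and $\rho_A=\mathrm{tr}_B[\rho_{AB}]$. Then both limits exist and $$\log\tilde\gamma^{\mathrm{reg}}_{\mathrm{SEP}}(\rho_{AB})=H(\rho_A),\qquad \log\gamma^{\mathrm{reg}}_{\mathrm{SEP}}(\rho_{AB})=H_{1/2}(\rho_A),$$ where $H(\rho)=-\mathrm{tr}[\rho\log\rho]$ is the von Neumann entropy and $H_{\alpha}(\rho)=\frac1{1-\alpha}\log\mathrm{tr}[\rho^\alpha]$ is the quantum Rényi entropy of order $\alpha$. Moreover, if $\dim A\ge2$ and $\dim B\ge2$, then $\tilde\gamma^{\mathrm{reg}}_{\mathrm{SEP}}(|\psi\rangle\langle\psi|)<\gamma^{\mathrm{reg}}_{\mathrm{SEP}}(|\psi\rangle\langle\psi|)$ for almost every unit vector $\psi$, with respect to the surface measure on the unit sphere of $\mathcal H_A\otimes\mathcal H_B$. -/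

import Mathlib

open MeasureTheory Filter Topology
open scoped ENNReal Matrix Kronecker ComplexOrder

noncomputable section

namespace QuasiprobabilityExtent

/-- Density operators on the system with Hilbert space `ℂ^ι`: positive semidefinite matrices of
trace one. -/
def IsDensity {ι : Type*} [Fintype ι] (ρ : Matrix ι ι ℂ) : Prop :=
  ρ.PosSemidef ∧ ρ.trace = 1

/-- `SEP(A;B)`: finite convex combinations of product states. -/
def sep (A B : Type*) [Fintype A] [Fintype B] : Set (Matrix (A × B) (A × B) ℂ) :=
  {ρ | ∃ (m : ℕ) (p : Fin m → ℝ) (σ : Fin m → Matrix A A ℂ) (τ : Fin m → Matrix B B ℂ),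
    (∀ i, 0 ≤ p i) ∧ ∑ i, p i = 1 ∧ (∀ i, IsDensity (σ i)) ∧ (∀ i, IsDensity (τ i)) ∧
    ρ = ∑ i, p i • (σ i ⊗ₖ τ i)}

/-- The quasiprobability extent of `ω` with respect to a decomposition set `S`: the infimum of
`∑ |a i|` over all finite decompositions `ω = ∑ a i • F i` with real `a i` and `F i ∈ S`
(`∞` if there is none). -/
def extent {ι : Type*} (S : Set (Matrix ι ι ℂ)) (ω : Matrix ι ι ℂ) : ℝ≥0∞ :=
  ⨅ (m : ℕ) (a : Fin m → ℝ) (F : Fin m → Matrix ι ι ℂ)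
    (_ : 1 ≤ m ∧ (∀ i, F i ∈ S) ∧ ω = ∑ i, a i • F i), ENNReal.ofReal (∑ i, |a i|)

/-- The trace norm (Schatten 1-norm) `tr √(X† X)`. -/
def traceNorm {ι : Type*} [Fintype ι] [DecidableEq ι] (X : Matrix ι ι ℂ) : ℝ :=
  (cfc Real.sqrt (Xᴴ * X)).trace.re

/-- The smoothed quasiprobability extent of a state: the extent minimised over all states within
trace distance `ε`. -/
def smoothedExtent {ι : Type*} [Fintype ι] [DecidableEq ι]
    (S : Set (Matrix ι ι ℂ)) (ε : ℝ) (ρ : Matrix ι ι ℂ) : ℝ≥0∞ :=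
  ⨅ (σ : Matrix ι ι ℂ) (_ : IsDensity σ ∧ (1 / 2) * traceNorm (ρ - σ) ≤ ε), extent S σ

/-- The `n`-fold tensor power of an operator on `AB`, regarded as an operator on the bipartite
system `AⁿBⁿ` (with `Aⁿ` on one side of the cut and `Bⁿ` on the other). -/
def tensorPower {A B : Type*} (ρ : Matrix (A × B) (A × B) ℂ) (n : ℕ) :
    Matrix ((Fin n → A) × (Fin n → B)) ((Fin n → A) × (Fin n → B)) ℂ :=
  Matrix.of fun x y => ∏ i, ρ (x.1 i, x.2 i) (y.1 i, y.2 i)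

variable {A B : Type*} [Fintype A] [Fintype B]

/-- The per-copy extent `γ_SEP(ρ^{⊗n})^{1/n}`. -/
def extentPerCopy (ρ : Matrix (A × B) (A × B) ℂ) (n : ℕ) : ℝ≥0∞ :=
  extent (sep (Fin n → A) (Fin n → B)) (tensorPower ρ n) ^ (1 / (n : ℝ))

/-- The regularized quasiprobability extent `lim_n γ_SEP(ρ^{⊗n})^{1/n}`. -/
def regularizedExtent (ρ : Matrix (A × B) (A × B) ℂ) : ℝ≥0∞ :=
  limUnder atTop (extentPerCopy ρ)

variable [DecidableEq A] [DecidableEq B]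

/-- `liminf_n γ_SEP^ε(ρ^{⊗n})^{1/n}`, as a function of `ε`. -/
def liminfSmoothedExtent (ρ : Matrix (A × B) (A × B) ℂ) (ε : ℝ) : ℝ≥0∞ :=
  liminf (fun n : ℕ =>
    smoothedExtent (sep (Fin n → A) (Fin n → B)) ε (tensorPower ρ n) ^ (1 / (n : ℝ))) atTop

/-- The asymptotic quasiprobability extent
`lim_{ε → 0⁺} liminf_n γ_SEP^ε(ρ^{⊗n})^{1/n}`. -/
def asymptoticExtent (ρ : Matrix (A × B) (A × B) ℂ) : ℝ≥0∞ :=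
  limUnder (𝓝[>] (0 : ℝ)) (liminfSmoothedExtent ρ)

/-- The rank-one projector `|ψ⟩⟨ψ|`. -/
def proj {ι : Type*} (ψ : EuclideanSpace ℂ ι) : Matrix ι ι ℂ :=
  Matrix.vecMulVec ψ.ofLp (star ψ.ofLp)

/-- The partial trace over `B`. -/
def partialTraceB (ρ : Matrix (A × B) (A × B) ℂ) : Matrix A A ℂ :=
  Matrix.of fun i j => ∑ b, ρ (i, b) (j, b)

/-- The von Neumann entropy `-tr[ρ log₂ ρ]`. -/
def vonNeumannEntropy {ι : Type*} [Fintype ι] [DecidableEq ι] (ρ : Matrix ι ι ℂ) : ℝ :=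
  (cfc (fun x : ℝ => -(x * Real.logb 2 x)) ρ).trace.re

/-- The quantum Rényi entropy `(1 - α)⁻¹ log₂ tr[ρ^α]` of order `α`. -/
def renyiEntropy {ι : Type*} [Fintype ι] [DecidableEq ι] (α : ℝ) (ρ : Matrix ι ι ℂ) : ℝ :=
  1 / (1 - α) * Real.logb 2 (cfc (fun x : ℝ => x ^ α) ρ).trace.re

/-- The base-2 logarithm `[0, ∞] → [-∞, ∞]`. -/
def log2 (x : ℝ≥0∞) : EReal := ENNReal.log x / (Real.log 2 : EReal)

end QuasiprobabilityExtent

end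

open QuasiprobabilityExtent

open MeasureTheory Filter Topology
open scoped ENNReal Matrix Kronecker ComplexOrder

noncomputable section

namespace QuasiprobabilityExtent

universe u v

/-! ### Tensor products of vectors -/

section Vectors

variable {A B K : Type*} [Fintype A] [Fintype B] [Fintype K]

/-! Write `ψ = ∑ √(p k) • u k ⊗ w k` (`exists_schmidt_decomposition`); the `n`-fold power has
Schmidt coefficients `∏ i, √(p (k i))`. Two one-shot bounds carry the proof. Polarization of the
cross terms gives extent at most `8 (∑ s)²` (`hasCost_proj_schmidtVec`). Conversely, a vector `φ`
with Schmidt coefficients `t` has squared overlap at most `max t²` with product unit vectors, so the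
extent of `ω` is at least `⟨φ|ω|φ⟩ / max t²` (`expect_le_mul_extent`). Constants disappear under the
`n`-th root.

Without smoothing, `t = 1` matches the upper bound up to the factor 8, giving `(∑ √p)²`, whose
logarithm is the Rényi entropy of order 1/2. With smoothing, the law of large numbers makes the
Schmidt spectrum nearly flat: truncation to sequences of probability at least `e^{-n(H+δ)}` gives
the upper bound, and truncation to those of probability at most `e^{-n(H-δ)}` is the witness for the
lower one.

The two entropies differ by strict Jensen unless `p` is uniform. A uniform spectrum of rank `r`
forces the quartic equation `r tr ρ_A² = (tr ρ_A)²`, whose zero set is null; there are countably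
many ranks. -/

/-- The product vector `x ⊗ y`. -/
def prodVec (x : EuclideanSpace ℂ A) (y : EuclideanSpace ℂ B) : EuclideanSpace ℂ (A × B) :=
  WithLp.toLp 2 fun i => x i.1 * y i.2

omit [Fintype A] [Fintype B] in
@[simp] lemma prodVec_apply (x : EuclideanSpace ℂ A) (y : EuclideanSpace ℂ B) (i : A × B) :
    prodVec x y i = x i.1 * y i.2 := rfl

/-- The product vector `x₁ ⊗ ⋯ ⊗ xₙ`. -/
def powVec {n : ℕ} (x : Fin n → EuclideanSpace ℂ A) : EuclideanSpace ℂ (Fin n → A) :=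
  WithLp.toLp 2 fun a => ∏ i, x i (a i)

omit [Fintype A] in
@[simp] lemma powVec_apply {n : ℕ} (x : Fin n → EuclideanSpace ℂ A) (a : Fin n → A) :
    powVec x a = ∏ i, x i (a i) := rfl

lemma inner_prodVec (x x' : EuclideanSpace ℂ A) (y y' : EuclideanSpace ℂ B) :
    inner ℂ (prodVec x y) (prodVec x' y') = inner ℂ x x' * inner ℂ y y' := by
  simp only [PiLp.inner_apply, prodVec_apply, RCLike.inner_apply, map_mul, Finset.sum_mul_sum,
    Fintype.sum_prod_type]
  exact Finset.sum_congr rfl fun _ _ => Finset.sum_congr rfl fun _ _ => by ring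

lemma inner_powVec {n : ℕ} (x y : Fin n → EuclideanSpace ℂ A) :
    inner ℂ (powVec x) (powVec y) = ∏ i, inner ℂ (x i) (y i) := by
  classical
  simp only [PiLp.inner_apply, powVec_apply, RCLike.inner_apply, map_prod,
    Finset.prod_univ_sum, Fintype.piFinset_univ, Finset.prod_mul_distrib]

omit [Fintype K] in
lemma orthonormal_powVec {u : K → EuclideanSpace ℂ A} (hu : Orthonormal ℂ u) (n : ℕ) :
    Orthonormal ℂ fun k : Fin n → K => powVec fun i => u (k i) := by
  classical
  rw [orthonormal_iff_ite] at hu ⊢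
  intro k l
  simp only [inner_powVec, hu, Finset.prod_ite_zero, Finset.prod_const_one, funext_iff,
    Finset.mem_univ, forall_true_left]

omit [Fintype K] in
lemma orthonormal_prodVec {u : K → EuclideanSpace ℂ A} {w : K → EuclideanSpace ℂ B}
    (hu : Orthonormal ℂ u) (hw : Orthonormal ℂ w) :
    Orthonormal ℂ fun k => prodVec (u k) (w k) := by
  classical
  rw [orthonormal_iff_ite] at hu hw ⊢
  intro k l
  rw [inner_prodVec, hu, hw]
  split_ifs <;> simp

/-- The vector `∑ k, s k • u k ⊗ w k`. -/
def schmidtVec (s : K → ℝ) (u : K → EuclideanSpace ℂ A) (w : K → EuclideanSpace ℂ B) :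
    EuclideanSpace ℂ (A × B) :=
  ∑ k, (s k : ℂ) • prodVec (u k) (w k)

omit [Fintype A] [Fintype B] in
lemma schmidtVec_apply (s : K → ℝ) (u : K → EuclideanSpace ℂ A) (w : K → EuclideanSpace ℂ B)
    (i : A × B) : schmidtVec s u w i = ∑ k, (s k : ℂ) * (u k i.1 * w k i.2) := by
  simp [schmidtVec]

lemma inner_schmidtVec {u : K → EuclideanSpace ℂ A} {w : K → EuclideanSpace ℂ B}
    (hu : Orthonormal ℂ u) (hw : Orthonormal ℂ w) (s t : K → ℝ) :
    inner ℂ (schmidtVec s u w) (schmidtVec t u w) = ((∑ k, s k * t k : ℝ) : ℂ) := by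
  rw [schmidtVec, schmidtVec, (orthonormal_prodVec hu hw).inner_sum]
  simp

lemma norm_schmidtVec_sq {u : K → EuclideanSpace ℂ A} {w : K → EuclideanSpace ℂ B}
    (hu : Orthonormal ℂ u) (hw : Orthonormal ℂ w) (s : K → ℝ) :
    ‖schmidtVec s u w‖ ^ 2 = ∑ k, s k ^ 2 := by
  have h := inner_schmidtVec hu hw s s
  rw [inner_self_eq_norm_sq_to_K] at h
  simp only [← sq] at h
  exact Complex.ofReal_injective (by simpa using h)

omit [Fintype A] [Fintype B] in
lemma schmidtVec_sub (s t : K → ℝ) (u : K → EuclideanSpace ℂ A) (w : K → EuclideanSpace ℂ B) :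
    schmidtVec s u w - schmidtVec t u w = schmidtVec (fun k => s k - t k) u w := by
  simp [schmidtVec, sub_smul]

/-- The squared overlap of a product vector with a vector of Schmidt coefficients `s` is at most
the largest squared Schmidt coefficient. -/
lemma norm_inner_schmidtVec_prodVec_sq_le {u : K → EuclideanSpace ℂ A}
    {w : K → EuclideanSpace ℂ B} (hu : Orthonormal ℂ u) (hw : Orthonormal ℂ w) {s : K → ℝ} {c : ℝ}
    (hc : 0 ≤ c) (hs : ∀ k, s k ^ 2 ≤ c) (x : EuclideanSpace ℂ A) (y : EuclideanSpace ℂ B) :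
    ‖inner ℂ (schmidtVec s u w) (prodVec x y)‖ ^ 2 ≤ c * (‖x‖ ^ 2 * ‖y‖ ^ 2) := by
  -- The weight `|s k|` is kept whole on the `x` factor, so that Cauchy–Schwarz followed by Bessel
  -- yields `c` exactly once.
  have h1 : ‖inner ℂ (schmidtVec s u w) (prodVec x y)‖ ≤
      ∑ k, (|s k| * ‖inner ℂ (u k) x‖) * ‖inner ℂ (w k) y‖ := by
    rw [schmidtVec, sum_inner]
    refine (norm_sum_le _ _).trans (Finset.sum_le_sum fun k _ => ?_)
    rw [inner_smul_left, inner_prodVec]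
    simp [mul_assoc]
  have hx : ∑ k, ‖inner ℂ (u k) x‖ ^ 2 ≤ ‖x‖ ^ 2 := hu.sum_inner_products_le x
  have hy : ∑ k, ‖inner ℂ (w k) y‖ ^ 2 ≤ ‖y‖ ^ 2 := hw.sum_inner_products_le y
  have hx' : ∑ k, (|s k| * ‖inner ℂ (u k) x‖) ^ 2 ≤ c * ∑ k, ‖inner ℂ (u k) x‖ ^ 2 := by
    rw [Finset.mul_sum]
    refine Finset.sum_le_sum fun k _ => ?_
    rw [mul_pow, sq_abs]
    exact mul_le_mul_of_nonneg_right (hs k) (by positivity)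
  calc ‖inner ℂ (schmidtVec s u w) (prodVec x y)‖ ^ 2
      ≤ (∑ k, (|s k| * ‖inner ℂ (u k) x‖) * ‖inner ℂ (w k) y‖) ^ 2 :=
        pow_le_pow_left₀ (norm_nonneg _) h1 2
    _ ≤ (∑ k, (|s k| * ‖inner ℂ (u k) x‖) ^ 2) * ∑ k, ‖inner ℂ (w k) y‖ ^ 2 :=
        Finset.sum_mul_sq_le_sq_mul_sq _ _ _
    _ ≤ (c * ‖x‖ ^ 2) * ‖y‖ ^ 2 := by
        refine mul_le_mul (hx'.trans (mul_le_mul_of_nonneg_left hx hc)) hy ?_ (by positivity)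
        positivity
    _ = _ := by ring

end Vectors

/-! ### Bounds on the extent -/

section Extent

/-- `ω` has a quasiprobability decomposition over `S` of total weight at most `r`. -/
def HasCost {ι : Type*} (S : Set (Matrix ι ι ℂ)) (ω : Matrix ι ι ℂ) (r : ℝ) : Prop :=
  ∃ (m : ℕ) (a : Fin m → ℝ) (F : Fin m → Matrix ι ι ℂ),
    (1 ≤ m ∧ (∀ i, F i ∈ S) ∧ ω = ∑ i, a i • F i) ∧ ∑ i, |a i| ≤ r

variable {ι : Type*} {S : Set (Matrix ι ι ℂ)} {X Y : Matrix ι ι ℂ} {r r' : ℝ}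

lemma HasCost.extent_le (h : HasCost S X r) : extent S X ≤ ENNReal.ofReal r := by
  obtain ⟨m, a, F, hF, hr⟩ := h
  exact iInf_le_of_le m <| iInf_le_of_le a <| iInf_le_of_le F <| iInf_le_of_le hF <|
    ENNReal.ofReal_le_ofReal hr

lemma HasCost.mono (h : HasCost S X r) (hr : r ≤ r') : HasCost S X r' := by
  obtain ⟨m, a, F, hF, h⟩ := h
  exact ⟨m, a, F, hF, h.trans hr⟩

lemma HasCost.add (hX : HasCost S X r) (hY : HasCost S Y r') : HasCost S (X + Y) (r + r') := by
  obtain ⟨m, a, F, ⟨hm, hF, rfl⟩, h⟩ := hX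
  obtain ⟨m', a', F', ⟨hm', hF', rfl⟩, h'⟩ := hY
  refine ⟨m + m', Fin.append a a', Fin.append F F', ⟨by omega, ?_, ?_⟩, ?_⟩
  · intro i
    refine Fin.addCases (fun i => ?_) (fun i => ?_) i
    · simpa using hF i
    · simpa using hF' i
  · simp [Fin.sum_univ_add]
  · simpa [Fin.sum_univ_add] using add_le_add h h'

lemma HasCost.smul (hX : HasCost S X r) (t : ℝ) : HasCost S (t • X) (|t| * r) := by
  obtain ⟨m, a, F, ⟨hm, hF, rfl⟩, h⟩ := hX
  refine ⟨m, fun i => t * a i, F, ⟨hm, hF, ?_⟩, ?_⟩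
  · simp [Finset.smul_sum, mul_smul]
  · simpa [abs_mul, ← Finset.mul_sum] using mul_le_mul_of_nonneg_left h (abs_nonneg t)

lemma hasCost_of_mem (h : X ∈ S) : HasCost S X 1 :=
  ⟨1, fun _ => 1, fun _ => X, ⟨le_rfl, fun _ => h, by simp⟩, by simp⟩

/-- Decompositions have at least one term, so zero needs some element of `S` with coefficient 0. -/
lemma hasCost_zero (hS : S.Nonempty) : HasCost S 0 0 := by
  obtain ⟨X, hX⟩ := hS
  simpa using (hasCost_of_mem hX).smul 0

lemma HasCost.sum (hS : S.Nonempty) {κ : Type*} (s : Finset κ) {X : κ → Matrix ι ι ℂ} {r : κ → ℝ}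
    (h : ∀ k, HasCost S (X k) (r k)) : HasCost S (∑ k ∈ s, X k) (∑ k ∈ s, r k) := by
  classical
  induction s using Finset.induction_on with
  | empty => simpa using hasCost_zero hS
  | insert k s hk ih => simpa [Finset.sum_insert hk] using (h k).add ih

lemma proj_apply (ψ : EuclideanSpace ℂ ι) (i j : ι) : proj ψ i j = ψ i * star (ψ j) := rfl

lemma proj_smul (c : ℂ) (ψ : EuclideanSpace ℂ ι) : proj (c • ψ) = (‖c‖ ^ 2 : ℝ) • proj ψ := by
  ext i j
  simp only [proj_apply, PiLp.smul_apply, smul_eq_mul, star_mul', Matrix.smul_apply,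
    Complex.real_smul]
  have := Complex.mul_conj' c
  push_cast
  rw [← this, starRingEnd_apply]
  ring

lemma trace_proj [Fintype ι] (ψ : EuclideanSpace ℂ ι) :
    (proj ψ).trace = ((‖ψ‖ ^ 2 : ℝ) : ℂ) := by
  rw [EuclideanSpace.norm_sq_eq]
  push_cast
  exact Finset.sum_congr rfl fun i _ => Complex.mul_conj' _

lemma isDensity_proj [Fintype ι] {ψ : EuclideanSpace ℂ ι} (hψ : ‖ψ‖ = 1) :
    IsDensity (proj ψ) :=
  ⟨Matrix.posSemidef_vecMulVec_self_star _, by simp [trace_proj, hψ]⟩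

variable {A B K : Type*} [Fintype A] [Fintype B] [Fintype K]

omit [Fintype A] [Fintype B] in
lemma proj_prodVec (x : EuclideanSpace ℂ A) (y : EuclideanSpace ℂ B) :
    proj (prodVec x y) = proj x ⊗ₖ proj y := by
  ext i j
  simp only [proj_apply, prodVec_apply, Matrix.kroneckerMap_apply, star_mul']
  ring

lemma proj_prodVec_mem_sep {x : EuclideanSpace ℂ A} {y : EuclideanSpace ℂ B}
    (hx : ‖x‖ = 1) (hy : ‖y‖ = 1) : proj (prodVec x y) ∈ sep A B :=
  ⟨1, fun _ => 1, fun _ => proj x, fun _ => proj y, by simp, by simp, fun _ => isDensity_proj hx,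
    fun _ => isDensity_proj hy, by simp [proj_prodVec]⟩

lemma sep_nonempty [Nonempty A] [Nonempty B] : (sep A B).Nonempty := by
  classical
  inhabit A
  inhabit B
  exact ⟨_, proj_prodVec_mem_sep (x := EuclideanSpace.single default 1)
    (y := EuclideanSpace.single default 1) (by simp) (by simp)⟩

/-- Homogeneous form, so that the vectors produced by polarization need not be normalized. -/
lemma hasCost_proj_prodVec [Nonempty A] [Nonempty B] (x : EuclideanSpace ℂ A)
    (y : EuclideanSpace ℂ B) : HasCost (sep A B) (proj (prodVec x y)) (‖x‖ ^ 2 * ‖y‖ ^ 2) := by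
  have hz : proj (0 : EuclideanSpace ℂ (A × B)) = 0 := by ext; simp [proj_apply]
  rcases eq_or_ne x 0 with rfl | hx
  · have : prodVec (0 : EuclideanSpace ℂ A) y = 0 := by ext; simp
    simpa [this, hz] using hasCost_zero sep_nonempty
  rcases eq_or_ne y 0 with rfl | hy
  · have : prodVec x (0 : EuclideanSpace ℂ B) = 0 := by ext; simp
    simpa [this, hz] using hasCost_zero sep_nonempty
  have hx' := norm_ne_zero_iff.2 hx
  have hy' := norm_ne_zero_iff.2 hy
  have h := (hasCost_of_mem (proj_prodVec_mem_sep (x := ((‖x‖⁻¹ : ℝ) : ℂ) • x)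
    (y := ((‖y‖⁻¹ : ℝ) : ℂ) • y) (by simp [norm_smul, hx]) (by simp [norm_smul, hy]))).smul
      (‖x‖ ^ 2 * ‖y‖ ^ 2)
  have he : prodVec (((‖x‖⁻¹ : ℝ) : ℂ) • x) (((‖y‖⁻¹ : ℝ) : ℂ) • y) =
      ((‖x‖⁻¹ * ‖y‖⁻¹ : ℝ) : ℂ) • prodVec x y := by
    ext i
    simp
    ring
  rw [he, proj_smul, smul_smul, mul_one, abs_of_nonneg (by positivity)] at h
  convert h using 1
  rw [Complex.norm_real, Real.norm_eq_abs, sq_abs]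
  field_simp
  simp

omit [Fintype A] [Fintype B] in
/-- Polarization of the cross terms of a superposition of two product vectors. -/
lemma vecMulVec_prodVec_add_swap (x x' : EuclideanSpace ℂ A) (y y' : EuclideanSpace ℂ B) :
    Matrix.vecMulVec (prodVec x y).ofLp (star (prodVec x' y').ofLp) +
      Matrix.vecMulVec (prodVec x' y').ofLp (star (prodVec x y).ofLp) =
    (1 / 8 : ℝ) • (proj (prodVec (x + x') (y + y')) + (-1 : ℝ) • proj (prodVec (x + x') (y - y')) +
      ((-1 : ℝ) • proj (prodVec (x - x') (y + y')) + proj (prodVec (x - x') (y - y'))) +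
      ((-1 : ℝ) • proj (prodVec (x + Complex.I • x') (y + Complex.I • y')) +
        proj (prodVec (x + Complex.I • x') (y - Complex.I • y')) +
      (proj (prodVec (x - Complex.I • x') (y + Complex.I • y')) +
        (-1 : ℝ) • proj (prodVec (x - Complex.I • x') (y - Complex.I • y'))))) := by
  -- For `P = |x⟩⟨x'|` and `Q = |y⟩⟨y'|`, `P⊗Q + P†⊗Q† = ½[(P+P†)⊗(Q+Q†) + (P-P†)⊗(Q-Q†)]`. Here
  -- `P+P†` is `1/2` times a difference of two projectors and `P-P†` is `i/2` times one; hence the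
  -- prefactor `1/8` and the opposite signs in the second group.
  ext i j
  have hI := Complex.I_sq
  simp only [Matrix.add_apply, Matrix.smul_apply, proj_apply, Matrix.vecMulVec_apply,
    prodVec_apply, Pi.star_apply, PiLp.add_apply, PiLp.sub_apply, PiLp.smul_apply, smul_eq_mul,
    star_mul', star_add, star_sub, Complex.real_smul, Complex.star_def, Complex.conj_I]
  push_cast
  ring_nf
  simp only [hI]
  ring

lemma hasCost_vecMulVec_prodVec_add_swap [Nonempty A] [Nonempty B]
    {x x' : EuclideanSpace ℂ A} {y y' : EuclideanSpace ℂ B}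
    (hx : ‖x‖ = 1) (hx' : ‖x'‖ = 1) (hy : ‖y‖ = 1) (hy' : ‖y'‖ = 1) :
    HasCost (sep A B) (Matrix.vecMulVec (prodVec x y).ofLp (star (prodVec x' y').ofLp) +
      Matrix.vecMulVec (prodVec x' y').ofLp (star (prodVec x y).ofLp)) 16 := by
  -- Eight projectors of cost at most `2² · 2² = 16`, times the prefactor `1/8`, give 16.
  have key : ∀ (a : EuclideanSpace ℂ A) (b : EuclideanSpace ℂ B), ‖a‖ ≤ 2 → ‖b‖ ≤ 2 →
      HasCost (sep A B) (proj (prodVec a b)) 16 := fun a b ha hb => by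
    refine (hasCost_proj_prodVec a b).mono ?_
    have h1 := pow_le_pow_left₀ (norm_nonneg a) ha 2
    have h2 := pow_le_pow_left₀ (norm_nonneg b) hb 2
    calc ‖a‖ ^ 2 * ‖b‖ ^ 2 ≤ 2 ^ 2 * 2 ^ 2 := mul_le_mul h1 h2 (by positivity) (by positivity)
      _ = 16 := by norm_num
  have key' : ∀ (a : EuclideanSpace ℂ A) (b : EuclideanSpace ℂ B), ‖a‖ ≤ 2 → ‖b‖ ≤ 2 →
      HasCost (sep A B) ((-1 : ℝ) • proj (prodVec a b)) 16 := fun a b ha hb => by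
    simpa using (key a b ha hb).smul (-1)
  have hix : ‖Complex.I • x'‖ = 1 := by simp [norm_smul, hx']
  have hiy : ‖Complex.I • y'‖ = 1 := by simp [norm_smul, hy']
  have hx1 : ‖x + x'‖ ≤ 2 := by linarith [norm_add_le x x']
  have hx2 : ‖x - x'‖ ≤ 2 := by linarith [norm_sub_le x x']
  have hx3 : ‖x + Complex.I • x'‖ ≤ 2 := by linarith [norm_add_le x (Complex.I • x')]
  have hx4 : ‖x - Complex.I • x'‖ ≤ 2 := by linarith [norm_sub_le x (Complex.I • x')]
  have hy1 : ‖y + y'‖ ≤ 2 := by linarith [norm_add_le y y']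
  have hy2 : ‖y - y'‖ ≤ 2 := by linarith [norm_sub_le y y']
  have hy3 : ‖y + Complex.I • y'‖ ≤ 2 := by linarith [norm_add_le y (Complex.I • y')]
  have hy4 : ‖y - Complex.I • y'‖ ≤ 2 := by linarith [norm_sub_le y (Complex.I • y')]
  rw [vecMulVec_prodVec_add_swap]
  have h := (((((key _ _ hx1 hy1).add (key' _ _ hx1 hy2)).add
    ((key' _ _ hx2 hy1).add (key _ _ hx2 hy2))).add
    (((key' _ _ hx3 hy3).add (key _ _ hx3 hy4)).add
    ((key _ _ hx4 hy3).add (key' _ _ hx4 hy4)))).smul (1 / 8))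
  exact h.mono (by rw [abs_of_pos (by norm_num)]; norm_num)

omit [Fintype A] [Fintype B] in
-- A single cross term is not Hermitian in general, hence no real combination of states;
-- symmetrizing the double sum repairs this. The resulting `1/2` turns the cost 16 of a pair into
-- the constant 8.
lemma proj_schmidtVec (s : K → ℝ) (u : K → EuclideanSpace ℂ A) (w : K → EuclideanSpace ℂ B) :
    proj (schmidtVec s u w) = ∑ k, ∑ l, (s k * s l * (1 / 2)) •
      (Matrix.vecMulVec (prodVec (u k) (w k)).ofLp (star (prodVec (u l) (w l)).ofLp) +
        Matrix.vecMulVec (prodVec (u l) (w l)).ofLp (star (prodVec (u k) (w k)).ofLp)) := by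
  have h1 : proj (schmidtVec s u w) = ∑ k, ∑ l, (s k * s l) •
      Matrix.vecMulVec (prodVec (u k) (w k)).ofLp (star (prodVec (u l) (w l)).ofLp) := by
    ext i j
    simp only [proj_apply, schmidtVec_apply, star_sum, Finset.sum_mul_sum, Matrix.sum_apply,
      Matrix.smul_apply, Matrix.vecMulVec_apply, Pi.star_apply, prodVec_apply, Complex.real_smul]
    refine Finset.sum_congr rfl fun k _ => Finset.sum_congr rfl fun l _ => ?_
    simp
    ring
  have h2 : proj (schmidtVec s u w) = ∑ k, ∑ l, (s k * s l) •
      Matrix.vecMulVec (prodVec (u l) (w l)).ofLp (star (prodVec (u k) (w k)).ofLp) := by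
    rw [h1, Finset.sum_comm]
    simp only [mul_comm]
  have h3 : proj (schmidtVec s u w) = (1 / 2 : ℝ) • proj (schmidtVec s u w) +
      (1 / 2 : ℝ) • proj (schmidtVec s u w) := by
    rw [← add_smul]
    norm_num
  rw [h3]
  nth_rewrite 1 [h1]
  rw [h2]
  simp only [Finset.smul_sum, ← Finset.sum_add_distrib, smul_smul, smul_add]
  refine Finset.sum_congr rfl fun k _ => Finset.sum_congr rfl fun l _ => ?_
  rw [mul_comm (1 / 2 : ℝ)]

/-- The extent of a pure state with Schmidt coefficients `s` is at most `8 (∑ s)²`. -/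
lemma hasCost_proj_schmidtVec [Nonempty A] [Nonempty B] {s : K → ℝ} (hs : ∀ k, 0 ≤ s k)
    {u : K → EuclideanSpace ℂ A} {w : K → EuclideanSpace ℂ B}
    (hu : ∀ k, ‖u k‖ = 1) (hw : ∀ k, ‖w k‖ = 1) :
    HasCost (sep A B) (proj (schmidtVec s u w)) (8 * (∑ k, s k) ^ 2) := by
  rw [proj_schmidtVec]
  refine (HasCost.sum sep_nonempty _ fun k => HasCost.sum sep_nonempty _ fun l =>
    (hasCost_vecMulVec_prodVec_add_swap (hu k) (hu l) (hw k) (hw l)).smul _).mono (le_of_eq ?_)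
  rw [sq, Finset.sum_mul_sum, Finset.mul_sum]
  refine Finset.sum_congr rfl fun k _ => ?_
  rw [Finset.mul_sum]
  refine Finset.sum_congr rfl fun l _ => ?_
  rw [abs_of_nonneg (mul_nonneg (mul_nonneg (hs k) (hs l)) (by norm_num))]
  ring

/-- The expectation value `⟨φ|X|φ⟩`. -/
def expect [Fintype ι] (φ : EuclideanSpace ℂ ι) (X : Matrix ι ι ℂ) : ℝ :=
  (star φ.ofLp ⬝ᵥ (X *ᵥ φ.ofLp)).re

lemma expect_sum [Fintype ι] {κ : Type*} (s : Finset κ) (φ : EuclideanSpace ℂ ι)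
    (X : κ → Matrix ι ι ℂ) : expect φ (∑ k ∈ s, X k) = ∑ k ∈ s, expect φ (X k) := by
  simp [expect, Matrix.sum_mulVec, dotProduct_sum]

lemma expect_smul [Fintype ι] (φ : EuclideanSpace ℂ ι) (t : ℝ) (X : Matrix ι ι ℂ) :
    expect φ (t • X) = t * expect φ X := by
  simp [expect, Matrix.smul_mulVec]

lemma expect_sub [Fintype ι] (φ : EuclideanSpace ℂ ι) (X Y : Matrix ι ι ℂ) :
    expect φ (X - Y) = expect φ X - expect φ Y := by
  simp [expect, Matrix.sub_mulVec]

lemma expect_proj [Fintype ι] (φ ψ : EuclideanSpace ℂ ι) :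
    expect φ (proj ψ) = ‖inner ℂ φ ψ‖ ^ 2 := by
  have h : star φ.ofLp ⬝ᵥ (proj ψ *ᵥ φ.ofLp) = inner ℂ φ ψ * inner ℂ ψ φ := by
    simp only [dotProduct, Matrix.mulVec, PiLp.inner_apply, RCLike.inner_apply, proj_apply,
      Pi.star_apply]
    rw [Finset.sum_mul_sum]
    simp only [Finset.mul_sum]
    refine Finset.sum_congr rfl fun i _ => Finset.sum_congr rfl fun j _ => ?_
    simp only [Complex.star_def]
    ring
  rw [expect, h, ← inner_conj_symm ψ φ, Complex.mul_conj']
  norm_cast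

-- From `σ = C† C`, the conjugated rows of `C` serve as the vectors.
open scoped MatrixOrder in
lemma exists_eq_sum_proj {σ : Matrix A A ℂ} (hσ : σ.PosSemidef) :
    ∃ x : A → EuclideanSpace ℂ A, σ = ∑ m, proj (x m) ∧ σ.trace.re = ∑ m, ‖x m‖ ^ 2 := by
  classical
  obtain ⟨C, hC⟩ := CStarAlgebra.nonneg_iff_eq_star_mul_self.1 hσ.nonneg
  rw [Matrix.star_eq_conjTranspose] at hC
  subst hC
  have h : Cᴴ * C = ∑ m, proj (WithLp.toLp 2 fun a => star (C m a)) := by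
    ext i j
    simp [Matrix.mul_apply, Matrix.sum_apply, proj_apply]
  refine ⟨_, h, ?_⟩
  rw [h, Matrix.trace_sum]
  simp only [trace_proj, Complex.re_sum, Complex.ofReal_re]

/-- Both density factors split into rank-one terms of total weight one, so the bound on product
vectors passes to products of states, and to `SEP` by convexity. -/
lemma abs_expect_le_of_mem_sep {φ : EuclideanSpace ℂ (A × B)} {c : ℝ}
    (hφ : ∀ x y, ‖inner ℂ φ (prodVec x y)‖ ^ 2 ≤ c * (‖x‖ ^ 2 * ‖y‖ ^ 2))
    {τ : Matrix (A × B) (A × B) ℂ} (hτ : τ ∈ sep A B) : |expect φ τ| ≤ c := by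
  have key : ∀ (σ : Matrix A A ℂ) (τ : Matrix B B ℂ), IsDensity σ → IsDensity τ →
      |expect φ (σ ⊗ₖ τ)| ≤ c := by
    intro σ τ hσ hτ
    obtain ⟨x, hx, hx'⟩ := exists_eq_sum_proj hσ.1
    obtain ⟨y, hy, hy'⟩ := exists_eq_sum_proj hτ.1
    rw [hσ.2, Complex.one_re] at hx'
    rw [hτ.2, Complex.one_re] at hy'
    have h : σ ⊗ₖ τ = ∑ m, ∑ n, proj (prodVec (x m) (y n)) := by
      simp only [proj_prodVec]
      ext i j
      simp [hx, hy, Matrix.sum_apply, Finset.sum_mul_sum]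
    simp only [h, expect_sum, expect_proj]
    rw [abs_of_nonneg (by positivity)]
    calc ∑ m, ∑ n, ‖inner ℂ φ (prodVec (x m) (y n))‖ ^ 2
        ≤ ∑ m, ∑ n, c * (‖x m‖ ^ 2 * ‖y n‖ ^ 2) :=
          Finset.sum_le_sum fun m _ => Finset.sum_le_sum fun n _ => hφ _ _
      _ = c * ((∑ m, ‖x m‖ ^ 2) * ∑ n, ‖y n‖ ^ 2) := by
          rw [Finset.sum_mul_sum]; simp only [Finset.mul_sum]
      _ = c := by rw [← hx', ← hy']; ring
  obtain ⟨m, p, σ, τ', hp, hp1, hσ, hτ', rfl⟩ := hτ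
  rw [expect_sum]
  calc |∑ i, expect φ (p i • (σ i ⊗ₖ τ' i))| ≤ ∑ i, |expect φ (p i • (σ i ⊗ₖ τ' i))| :=
        Finset.abs_sum_le_sum_abs _ _
    _ ≤ ∑ i, p i * c := Finset.sum_le_sum fun i _ => by
        rw [expect_smul, abs_mul, abs_of_nonneg (hp i)]
        exact mul_le_mul_of_nonneg_left (key _ _ (hσ i) (hτ' i)) (hp i)
    _ = c := by rw [← Finset.sum_mul, hp1, one_mul]

/-- Lower bound on the extent from a rank-one witness. -/
lemma expect_le_mul_extent {φ : EuclideanSpace ℂ (A × B)} {c : ℝ} (hc : 0 < c)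
    (hφ : ∀ x y, ‖inner ℂ φ (prodVec x y)‖ ^ 2 ≤ c * (‖x‖ ^ 2 * ‖y‖ ^ 2))
    (X : Matrix (A × B) (A × B) ℂ) :
    ENNReal.ofReal (expect φ X / c) ≤ extent (sep A B) X := by
  refine le_iInf fun m => le_iInf fun a => le_iInf fun F => le_iInf fun ⟨_, hF, hX⟩ => ?_
  refine ENNReal.ofReal_le_ofReal ?_
  rw [div_le_iff₀ hc, hX, expect_sum, Finset.sum_mul]
  refine Finset.sum_le_sum fun i _ => ?_
  rw [expect_smul]
  refine (le_abs_self _).trans ?_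
  rw [abs_mul]
  exact mul_le_mul_of_nonneg_left (abs_expect_le_of_mem_sep hφ (hF i)) (abs_nonneg _)

end Extent

/-! ### The trace norm -/

section TraceNorm

variable {ι : Type*} [Fintype ι] [DecidableEq ι] {X : Matrix ι ι ℂ}

lemma trace_cfc (hX : X.IsHermitian) (f : ℝ → ℝ) :
    (cfc f X).trace = ∑ i, ((f (hX.eigenvalues i) : ℝ) : ℂ) := by
  rw [hX.cfc_eq, Matrix.IsHermitian.cfc, Unitary.conjStarAlgAut_apply, Matrix.trace_mul_cycle,
    Unitary.coe_star_mul_self, one_mul, Matrix.trace_diagonal]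
  rfl

lemma traceNorm_eq (hX : X.IsHermitian) : traceNorm X = ∑ i, |hX.eigenvalues i| := by
  have h : cfc Real.sqrt (Xᴴ * X) = cfc (fun x : ℝ => |x|) X := by
    have h2 := cfc_comp_pow Real.sqrt 2 X (ha := hX)
    simp only [Real.sqrt_sq_eq_abs] at h2
    rw [hX.eq, ← sq, h2]
  rw [traceNorm, h, trace_cfc hX]
  simp

lemma spectral_sum (hX : X.IsHermitian) :
    X = ∑ k, hX.eigenvalues k • proj (hX.eigenvectorBasis k) := by
  conv_lhs => rw [hX.spectral_theorem, Unitary.conjStarAlgAut_apply]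
  ext i j
  rw [Matrix.mul_apply]
  simp only [Matrix.mul_diagonal, Matrix.sum_apply, Matrix.smul_apply,
    proj_apply, Complex.real_smul, Function.comp, Matrix.star_apply,
    Matrix.IsHermitian.eigenvectorUnitary_apply]
  refine Finset.sum_congr rfl fun k _ => ?_
  simp only [Complex.coe_algebraMap]
  ring

/-- The operator norm is at most the trace norm; this crude form suffices because only small `ε`
matter. -/
lemma abs_expect_le (hX : X.IsHermitian) (v : EuclideanSpace ℂ ι) :
    |expect v X| ≤ traceNorm X * ‖v‖ ^ 2 := by
  have h : expect v X = ∑ k, hX.eigenvalues k * ‖inner ℂ v (hX.eigenvectorBasis k)‖ ^ 2 := by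
    conv_lhs => rw [spectral_sum hX, expect_sum]
    simp only [expect_smul, expect_proj]
  rw [h, traceNorm_eq hX, Finset.sum_mul]
  refine (Finset.abs_sum_le_sum_abs _ _).trans (Finset.sum_le_sum fun k _ => ?_)
  rw [abs_mul, abs_of_nonneg (sq_nonneg ‖_‖)]
  refine mul_le_mul_of_nonneg_left (pow_le_pow_left₀ (norm_nonneg _) ?_ 2) (abs_nonneg _)
  simpa using norm_inner_le_norm (𝕜 := ℂ) v (hX.eigenvectorBasis k)

omit [DecidableEq ι] in
lemma isHermitian_proj (ψ : EuclideanSpace ℂ ι) : (proj ψ).IsHermitian :=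
  (Matrix.posSemidef_vecMulVec_self_star _).1

/-- In an eigenbasis of the difference each eigenvalue is `|⟨u k, a⟩|² - |⟨u k, b⟩|²`. Factoring
this difference of squares and applying Cauchy–Schwarz and Bessel gives the bound. -/
lemma traceNorm_proj_sub_proj_le {a b : EuclideanSpace ℂ ι} (ha : ‖a‖ = 1) (hb : ‖b‖ = 1) :
    traceNorm (proj a - proj b) ≤ 2 * ‖a - b‖ := by
  have hX := (isHermitian_proj a).sub (isHermitian_proj b)
  rw [traceNorm_eq hX]
  set u := hX.eigenvectorBasis with hu
  have hl : ∀ k, |hX.eigenvalues k| ≤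
      ‖inner ℂ (u k) (a - b)‖ * (‖inner ℂ (u k) a‖ + ‖inner ℂ (u k) b‖) := by
    intro k
    have h1 : expect (u k) (proj a - proj b) = hX.eigenvalues k := by
      conv_lhs => rw [spectral_sum hX, expect_sum]
      simp only [expect_smul, expect_proj]
      rw [Finset.sum_eq_single k]
      · simp [hu]
      · intro l _ hl
        rw [hu, hX.eigenvectorBasis.inner_eq_zero hl.symm]
        simp
      · simp
    rw [← h1, expect_sub, expect_proj, expect_proj, sq_sub_sq, abs_mul, mul_comm,
      abs_of_nonneg (by positivity : 0 ≤ ‖inner ℂ (u k) a‖ + ‖inner ℂ (u k) b‖), inner_sub_right]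
    exact mul_le_mul_of_nonneg_right (abs_norm_sub_norm_le _ _) (by positivity)
  have hB : ∀ v, ∑ k, ‖inner ℂ (u k) v‖ ^ 2 ≤ ‖v‖ ^ 2 := fun v =>
    u.orthonormal.sum_inner_products_le v
  refine abs_le_of_sq_le_sq' ?_ (by positivity) |>.2
  calc (∑ k, |hX.eigenvalues k|) ^ 2
      ≤ (∑ k, ‖inner ℂ (u k) (a - b)‖ * (‖inner ℂ (u k) a‖ + ‖inner ℂ (u k) b‖)) ^ 2 :=
        pow_le_pow_left₀ (by positivity) (Finset.sum_le_sum fun k _ => hl k) 2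
    _ ≤ (∑ k, ‖inner ℂ (u k) (a - b)‖ ^ 2) *
          ∑ k, (‖inner ℂ (u k) a‖ + ‖inner ℂ (u k) b‖) ^ 2 :=
        Finset.sum_mul_sq_le_sq_mul_sq _ _ _
    _ ≤ ‖a - b‖ ^ 2 * 4 := by
        refine mul_le_mul (hB _) ?_ (by positivity) (by positivity)
        calc ∑ k, (‖inner ℂ (u k) a‖ + ‖inner ℂ (u k) b‖) ^ 2
            ≤ ∑ k, (2 * ‖inner ℂ (u k) a‖ ^ 2 + 2 * ‖inner ℂ (u k) b‖ ^ 2) :=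
              Finset.sum_le_sum fun k _ => by
                nlinarith [sq_nonneg (‖inner ℂ (u k) a‖ - ‖inner ℂ (u k) b‖)]
          _ ≤ 4 := by
              rw [Finset.sum_add_distrib, ← Finset.mul_sum, ← Finset.mul_sum]
              have h1 := hB a
              have h2 := hB b
              rw [ha] at h1
              rw [hb] at h2
              linarith
    _ = (2 * ‖a - b‖) ^ 2 := by ring

end TraceNorm

/-! ### Typical sequences -/

section Typical

variable {K : Type*} [Fintype K] {p : K → ℝ}

/-- Chernoff bound for i.i.d. sums on a finite probability space. -/
lemma exists_sum_prod_filter_le_pow (hp : ∀ k, 0 < p k) (hp1 : ∑ k, p k = 1) {f : K → ℝ}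
    (hf : ∑ k, p k * f k = 0) {δ : ℝ} (hδ : 0 < δ) :
    ∃ r : ℝ, 0 ≤ r ∧ r < 1 ∧ ∀ n : ℕ,
      ∑ k : Fin n → K with ¬ ∑ i, f (k i) ≤ n * δ, ∏ i, p (k i) ≤ r ^ n := by
  -- Moment generating function of `f - δ`: `g 0 = 1` and `g' 0 = -δ < 0` as `f` has mean zero, so
  -- `g t < 1` for some `t > 0`. The exponential weight is at least 1 on the bad sequences, whence
  -- the bound `g t ^ n`.
  set g : ℝ → ℝ := fun t => ∑ k, p k * Real.exp (t * (f k - δ)) with hg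
  have hg0 : g 0 = 1 := by simp [hg, hp1]
  have hd : HasDerivAt g (-δ) 0 := by
    have h : HasDerivAt g (∑ k, p k * (Real.exp (0 * (f k - δ)) * (1 * (f k - δ)))) 0 :=
      HasDerivAt.fun_sum fun k _ =>
        (((hasDerivAt_id (0 : ℝ)).mul_const (f k - δ)).exp.const_mul (p k))
    convert h using 1
    simp [mul_sub, Finset.sum_sub_distrib, hf, ← Finset.sum_mul, hp1]
  have hev : ∀ᶠ t in 𝓝[>] (0 : ℝ), g t < 1 := by
    have h := ((hasDerivAt_iff_tendsto_slope.1 hd).eventually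
      (gt_mem_nhds (neg_lt_zero.2 hδ))).filter_mono
        (nhdsWithin_mono 0 fun x (hx : 0 < x) => hx.ne')
    filter_upwards [h, self_mem_nhdsWithin] with t ht ht0
    rw [slope_def_field, div_lt_iff₀ (by simpa using ht0), hg0] at ht
    linarith
  obtain ⟨t, htg, ht0⟩ := (hev.and self_mem_nhdsWithin).exists
  have ht0 : 0 < t := ht0
  refine ⟨g t, Finset.sum_nonneg fun k _ => mul_nonneg (hp k).le (Real.exp_pos _).le, htg,
    fun n => ?_⟩
  have hP : ∀ k : Fin n → K, 0 < ∏ i, p (k i) := fun k => Finset.prod_pos fun i _ => hp _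
  calc ∑ k : Fin n → K with ¬ ∑ i, f (k i) ≤ n * δ, ∏ i, p (k i)
      ≤ ∑ k : Fin n → K with ¬ ∑ i, f (k i) ≤ n * δ,
          ∏ i, p (k i) * Real.exp (t * (f (k i) - δ)) := by
        refine Finset.sum_le_sum fun k hk => ?_
        rw [Finset.prod_mul_distrib, ← Real.exp_sum]
        refine le_mul_of_one_le_right (hP k).le (Real.one_le_exp ?_)
        rw [← Finset.mul_sum, Finset.sum_sub_distrib]
        have := (Finset.mem_filter.1 hk).2
        simp only [Finset.sum_const, Finset.card_univ, Fintype.card_fin, nsmul_eq_mul]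
        exact mul_nonneg ht0.le (by linarith)
    _ ≤ ∑ k : Fin n → K, ∏ i, p (k i) * Real.exp (t * (f (k i) - δ)) :=
        Finset.sum_le_sum_of_subset_of_nonneg (Finset.subset_univ _) fun k _ _ =>
          Finset.prod_nonneg fun i _ => mul_nonneg (hp _).le (Real.exp_pos _).le
    _ = g t ^ n := by rw [hg, Fintype.sum_pow]

lemma sum_prod_eq_one (hp1 : ∑ k, p k = 1) (n : ℕ) : ∑ k : Fin n → K, ∏ i, p (k i) = 1 := by
  rw [← Fintype.sum_pow, hp1, one_pow]

/-- Weak law of large numbers on a finite probability space. -/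
lemma tendsto_sum_prod_filter (hp : ∀ k, 0 < p k) (hp1 : ∑ k, p k = 1) {f : K → ℝ}
    (hf : ∑ k, p k * f k = 0) {δ : ℝ} (hδ : 0 < δ) :
    Tendsto (fun n : ℕ => ∑ k : Fin n → K with ∑ i, f (k i) ≤ n * δ, ∏ i, p (k i))
      atTop (𝓝 1) := by
  obtain ⟨r, hr0, hr1, hr⟩ := exists_sum_prod_filter_le_pow hp hp1 hf hδ
  have hsplit : ∀ n : ℕ, (∑ k : Fin n → K with ∑ i, f (k i) ≤ n * δ, ∏ i, p (k i)) +
      ∑ k : Fin n → K with ¬ ∑ i, f (k i) ≤ n * δ, ∏ i, p (k i) = 1 := fun n => by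
    rw [Finset.sum_filter_add_sum_filter_not, sum_prod_eq_one hp1]
  have hlim : Tendsto (fun n : ℕ => 1 - r ^ n) atTop (𝓝 1) := by
    simpa using (tendsto_pow_atTop_nhds_zero_of_lt_one hr0 hr1).const_sub 1
  refine tendsto_of_tendsto_of_tendsto_of_le_of_le hlim tendsto_const_nhds (fun n => ?_)
    fun n => ?_
  · have h1 := hsplit n
    have h2 := hr n
    linarith
  · have h1 := hsplit n
    have h2 : 0 ≤ ∑ k : Fin n → K with ¬ ∑ i, f (k i) ≤ n * δ, ∏ i, p (k i) :=
      Finset.sum_nonneg fun k _ => Finset.prod_nonneg fun i _ => (hp _).le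
    linarith

/-- The surprisal has mean equal to the Shannon entropy; its centred version is what the law of
large numbers is applied to. -/
lemma sum_mul_neg_log_sub (hp1 : ∑ k, p k = 1) :
    ∑ k, p k * (-Real.log (p k) - ∑ l, Real.negMulLog (p l)) = 0 := by
  simp only [mul_sub, Finset.sum_sub_distrib, ← Finset.sum_mul, hp1, Real.negMulLog]
  simp

omit [Fintype K] in
lemma prod_eq_exp_sum_log (hp : ∀ k, 0 < p k) {n : ℕ} (k : Fin n → K) :
    ∏ i, p (k i) = Real.exp (∑ i, Real.log (p (k i))) := by
  rw [Real.exp_sum]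
  exact Finset.prod_congr rfl fun i _ => (Real.exp_log (hp _)).symm

end Typical

/-! ### Extents of many copies of a pure state -/

section Copies

/-- This is why constant factors in the one-shot bounds are harmless. -/
lemma tendsto_ofReal_mul_pow_rpow {C S : ℝ} (hC : 0 < C) (hS : 0 < S) :
    Tendsto (fun n : ℕ => ENNReal.ofReal (C * S ^ n) ^ (1 / (n : ℝ))) atTop
      (𝓝 (ENNReal.ofReal S)) := by
  have h1 : Tendsto (fun n : ℕ => C ^ (1 / (n : ℝ)) * S) atTop (𝓝 S) := by
    have := (tendsto_const_nhds (x := C)).rpow tendsto_one_div_atTop_nhds_zero_nat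
      (Or.inl hC.ne')
    simpa using this.mul_const S
  refine (ENNReal.tendsto_ofReal h1).congr' ?_
  filter_upwards [eventually_gt_atTop 0] with n hn
  have hn' : (n : ℝ) ≠ 0 := by positivity
  rw [ENNReal.ofReal_rpow_of_nonneg (by positivity) (by positivity),
    Real.mul_rpow hC.le (by positivity), ← Real.rpow_natCast S, ← Real.rpow_mul hS.le,
    mul_one_div_cancel hn', Real.rpow_one]

variable {A B K : Type*} [Fintype A] [Fintype B] [Fintype K]

omit [Fintype A] [Fintype B] in
lemma tensorPower_proj_schmidtVec (s : K → ℝ) (u : K → EuclideanSpace ℂ A)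
    (w : K → EuclideanSpace ℂ B) (n : ℕ) :
    tensorPower (proj (schmidtVec s u w)) n =
      proj (schmidtVec (fun k : Fin n → K => ∏ i, s (k i))
        (fun k => powVec fun i => u (k i)) fun k => powVec fun i => w (k i)) := by
  classical
  have h : ∀ x : (Fin n → A) × (Fin n → B), ∏ i, schmidtVec s u w (x.1 i, x.2 i) =
      schmidtVec (fun k : Fin n → K => ∏ i, s (k i))
        (fun k => powVec fun i => u (k i)) (fun k => powVec fun i => w (k i)) x := fun x => by
    simp only [schmidtVec_apply, powVec_apply, Finset.prod_univ_sum, Fintype.piFinset_univ,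
      Finset.prod_mul_distrib, Complex.ofReal_prod]
  ext x y
  rw [proj_apply, ← h, ← h]
  simp [tensorPower, proj_apply, Finset.prod_mul_distrib]

variable [Nonempty A] [Nonempty B] {u : K → EuclideanSpace ℂ A} {w : K → EuclideanSpace ℂ B}

/-- The regularized extent of a pure state is the squared sum of its Schmidt coefficients. -/
lemma tendsto_extentPerCopy (hu : Orthonormal ℂ u) (hw : Orthonormal ℂ w) {s : K → ℝ}
    (hs : ∀ k, 0 ≤ s k) (hs' : 0 < ∑ k, s k) :
    Tendsto (extentPerCopy (proj (schmidtVec s u w))) atTop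
      (𝓝 (ENNReal.ofReal ((∑ k, s k) ^ 2))) := by
  have hS : ∀ n : ℕ, (∑ k : Fin n → K, ∏ i, s (k i)) ^ 2 = ((∑ k, s k) ^ 2) ^ n := fun n => by
    rw [← Fintype.sum_pow, ← pow_mul, ← pow_mul, mul_comm]
  refine tendsto_of_tendsto_of_tendsto_of_le_of_le
    (tendsto_ofReal_mul_pow_rpow one_pos (pow_pos hs' 2))
    (tendsto_ofReal_mul_pow_rpow (C := 8) (by norm_num) (pow_pos hs' 2)) (fun n => ?_) fun n => ?_
  · refine ENNReal.rpow_le_rpow ?_ (by positivity)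
    have hU := orthonormal_powVec hu n
    have hW := orthonormal_powVec hw n
    -- The witness is the unnormalized maximally entangled vector in the Schmidt bases: all
    -- coefficients are 1, so `c = 1`, and its overlap with the state is the sum of the Schmidt
    -- coefficients.
    have h := expect_le_mul_extent one_pos
      (norm_inner_schmidtVec_prodVec_sq_le hU hW zero_le_one (s := fun _ => 1) (by simp))
      (tensorPower (proj (schmidtVec s u w)) n)
    refine le_of_eq_of_le ?_ h
    rw [tensorPower_proj_schmidtVec, expect_proj, inner_schmidtVec hU hW, Complex.norm_real,
      Real.norm_eq_abs, sq_abs]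
    simp [hS]
  · refine ENNReal.rpow_le_rpow ?_ (by positivity)
    rw [tensorPower_proj_schmidtVec, ← hS]
    exact (hasCost_proj_schmidtVec (fun k => Finset.prod_nonneg fun i _ => hs _)
      (orthonormal_powVec hu n).1 (orthonormal_powVec hw n).1).extent_le

variable [DecidableEq A] [DecidableEq B] {p : K → ℝ}

/-- Truncating to the typical Schmidt coefficients bounds the smoothed extent from above. -/
lemma eventually_smoothedExtent_le (hu : Orthonormal ℂ u) (hw : Orthonormal ℂ w)
    (hp : ∀ k, 0 < p k) (hp1 : ∑ k, p k = 1) {ε δ : ℝ} (hε : 0 < ε) (hδ : 0 < δ) :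
    ∀ᶠ n : ℕ in atTop, smoothedExtent (sep (Fin n → A) (Fin n → B)) ε
      (tensorPower (proj (schmidtVec (fun k => √(p k)) u w)) n) ≤
        ENNReal.ofReal (8 * Real.exp (∑ k, Real.negMulLog (p k) + δ) ^ n) := by
  classical
  set H := ∑ k, Real.negMulLog (p k) with hH
  have hlim := tendsto_sum_prod_filter hp hp1 (sum_mul_neg_log_sub hp1) hδ
  -- `2 - 2√q` is the squared distance from the state to its renormalized truncation, `q` being the
  -- retained probability.
  have hlim' : Tendsto (fun n : ℕ => 2 - 2 * √(∑ k : Fin n → K with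
      ∑ i, (-Real.log (p (k i)) - H) ≤ n * δ, ∏ i, p (k i))) atTop (𝓝 0) := by
    simpa using (hlim.sqrt.const_mul 2).const_sub 2
  filter_upwards [hlim.eventually (lt_mem_nhds zero_lt_one),
    hlim'.eventually (gt_mem_nhds (pow_pos hε 2))] with n hq hqε
  -- These are the sequences of probability at least `e^{-n(H+δ)}`, so there are at most
  -- `e^{n(H+δ)}` of them.
  set T : Finset (Fin n → K) := {k | ∑ i, (-Real.log (p (k i)) - H) ≤ n * δ} with hT
  set q := ∑ k ∈ T, ∏ i, p (k i) with hqdef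
  set s : (Fin n → K) → ℝ := fun k => √(∏ i, p (k i)) with hs
  set t : (Fin n → K) → ℝ := fun k => if k ∈ T then s k / √q else 0 with ht
  have hP : ∀ k : Fin n → K, 0 < ∏ i, p (k i) := fun k => Finset.prod_pos fun i _ => hp _
  have hss : ∀ k, s k ^ 2 = ∏ i, p (k i) := fun k => Real.sq_sqrt (hP k).le
  have hq2 : √q ^ 2 = q := Real.sq_sqrt hq.le
  have hqpos : 0 < √q := Real.sqrt_pos.2 hq
  have hU := orthonormal_powVec hu n
  have hW := orthonormal_powVec hw n
  set U := fun k : Fin n → K => powVec fun i => u (k i)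
  set W := fun k : Fin n → K => powVec fun i => w (k i)
  have hψ : tensorPower (proj (schmidtVec (fun k => √(p k)) u w)) n =
      proj (schmidtVec s U W) := by
    rw [tensorPower_proj_schmidtVec]
    congr 2
    ext k
    exact (Real.sqrt_prod _ fun i _ => (hp _).le).symm
  have hsum_s : ∑ k, s k ^ 2 = 1 := by simp only [hss]; exact sum_prod_eq_one hp1 n
  have hsum_t : ∑ k, t k ^ 2 = 1 := by
    simp only [ht, ite_pow, Finset.sum_ite_mem, Finset.univ_inter, div_pow, hss, hq2,
      ne_eq, OfNat.ofNat_ne_zero, not_false_eq_true, zero_pow, ← Finset.sum_div]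
    exact div_self hq.ne'
  have hsum_st : ∑ k, s k * t k = √q := by
    simp only [ht, mul_ite, mul_zero, Finset.sum_ite_mem, Finset.univ_inter, ← mul_div_assoc,
      ← sq, hss, ← Finset.sum_div]
    rw [div_eq_iff hqpos.ne', ← sq, hq2]
  have hns : ‖schmidtVec s U W‖ = 1 := by
    rw [← sq_eq_sq₀ (norm_nonneg _) zero_le_one, norm_schmidtVec_sq hU hW, hsum_s, one_pow]
  have hnt : ‖schmidtVec t U W‖ = 1 := by
    rw [← sq_eq_sq₀ (norm_nonneg _) zero_le_one, norm_schmidtVec_sq hU hW, hsum_t, one_pow]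
  have hdist : ‖schmidtVec s U W - schmidtVec t U W‖ ≤ ε := by
    refine (abs_le_of_sq_le_sq' ?_ hε.le).2
    rw [schmidtVec_sub, norm_schmidtVec_sq hU hW]
    simp only [sub_sq, Finset.sum_add_distrib, Finset.sum_sub_distrib, hsum_s, hsum_t,
      mul_assoc, ← Finset.mul_sum, hsum_st]
    linarith
  have hcard : (T.card : ℝ) ≤ Real.exp (H + δ) ^ n := by
    have h1 : ∑ k ∈ T, Real.exp (-(n * (H + δ))) ≤ 1 := by
      rw [← sum_prod_eq_one hp1 n]
      refine (Finset.sum_le_sum fun k hk => ?_).trans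
        (Finset.sum_le_sum_of_subset_of_nonneg (Finset.subset_univ T) fun k _ _ => (hP k).le)
      rw [prod_eq_exp_sum_log hp]
      have h2 := (Finset.mem_filter.1 hk).2
      rw [Finset.sum_sub_distrib, Finset.sum_neg_distrib, Finset.sum_const, Finset.card_univ,
        Fintype.card_fin, nsmul_eq_mul] at h2
      exact Real.exp_le_exp.2 (by linarith)
    rw [Finset.sum_const, nsmul_eq_mul, Real.exp_neg, ← div_eq_mul_inv,
      div_le_one (Real.exp_pos _)] at h1
    rwa [← Real.exp_nat_mul]
  -- Cauchy–Schwarz: `t` is a unit vector supported on `T`.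
  have hsum : (∑ k, t k) ^ 2 ≤ T.card := by
    have h1 : ∑ k, t k = ∑ k ∈ T, t k := by
      simp only [ht, Finset.sum_ite_mem, Finset.univ_inter, Finset.inter_self]
    rw [h1]
    refine (sq_sum_le_card_mul_sum_sq).trans (mul_le_of_le_one_right (by positivity) ?_)
    rw [← hsum_t]
    exact Finset.sum_le_sum_of_subset_of_nonneg (Finset.subset_univ T) fun k _ _ => sq_nonneg _
  have ht0 : ∀ k, 0 ≤ t k := fun k => by
    simp only [ht]
    split_ifs
    · exact div_nonneg (Real.sqrt_nonneg _) (Real.sqrt_nonneg _)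
    · exact le_rfl
  refine iInf₂_le_of_le (proj (schmidtVec t U W)) ⟨isDensity_proj hnt, ?_⟩ ?_
  · rw [hψ]
    linarith [traceNorm_proj_sub_proj_le hns hnt]
  · exact ((hasCost_proj_schmidtVec ht0 hU.1 hW.1).mono
      (mul_le_mul_of_nonneg_left (hsum.trans hcard) (by norm_num))).extent_le

omit [Nonempty A] [Nonempty B] in
/-- The truncation to the typical Schmidt coefficients is a witness bounding the smoothed extent
from below. -/
lemma eventually_le_smoothedExtent (hu : Orthonormal ℂ u) (hw : Orthonormal ℂ w)
    (hp : ∀ k, 0 < p k) (hp1 : ∑ k, p k = 1) {ε δ : ℝ} (hε : ε < 1 / 8) (hδ : 0 < δ) :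
    ∀ᶠ n : ℕ in atTop, ENNReal.ofReal (1 / 8 * Real.exp (∑ k, Real.negMulLog (p k) - δ) ^ n) ≤
      smoothedExtent (sep (Fin n → A) (Fin n → B)) ε
        (tensorPower (proj (schmidtVec (fun k => √(p k)) u w)) n) := by
  classical
  set H := ∑ k, Real.negMulLog (p k) with hH
  have hf : ∑ k, p k * -(-Real.log (p k) - H) = 0 := by
    simp only [mul_neg, Finset.sum_neg_distrib, hH, sum_mul_neg_log_sub hp1, neg_zero]
  have hlim := tendsto_sum_prod_filter hp hp1 hf hδ
  filter_upwards [hlim.eventually (lt_mem_nhds one_half_lt_one)] with n hq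
  -- With the sign reversed, these are the sequences of probability at most `e^{-n(H-δ)}`, which
  -- bounds the squared coefficients of the witness.
  set T : Finset (Fin n → K) := {k | ∑ i, -(-Real.log (p (k i)) - H) ≤ n * δ} with hT
  set q := ∑ k ∈ T, ∏ i, p (k i) with hqdef
  set s : (Fin n → K) → ℝ := fun k => √(∏ i, p (k i)) with hs
  set t : (Fin n → K) → ℝ := fun k => if k ∈ T then s k else 0 with ht
  have hP : ∀ k : Fin n → K, 0 < ∏ i, p (k i) := fun k => Finset.prod_pos fun i _ => hp _
  have hss : ∀ k, s k ^ 2 = ∏ i, p (k i) := fun k => Real.sq_sqrt (hP k).le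
  have hU := orthonormal_powVec hu n
  have hW := orthonormal_powVec hw n
  set U := fun k : Fin n → K => powVec fun i => u (k i)
  set W := fun k : Fin n → K => powVec fun i => w (k i)
  have hψ : tensorPower (proj (schmidtVec (fun k => √(p k)) u w)) n =
      proj (schmidtVec s U W) := by
    rw [tensorPower_proj_schmidtVec]
    congr 2
    ext k
    exact (Real.sqrt_prod _ fun i _ => (hp _).le).symm
  have hsum_t : ∑ k, t k ^ 2 = q := by
    simp only [ht, ite_pow, Finset.sum_ite_mem, Finset.univ_inter, hss, ne_eq,
      OfNat.ofNat_ne_zero, not_false_eq_true, zero_pow, hqdef]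
  have hsum_ts : ∑ k, t k * s k = q := by
    simp only [ht, ite_mul, zero_mul, Finset.sum_ite_mem, Finset.univ_inter, ← sq, hss, hqdef]
  set c := (Real.exp (H - δ) ^ n)⁻¹ with hc
  have hcpos : 0 < c := by positivity
  have htc : ∀ k, t k ^ 2 ≤ c := fun k => by
    simp only [ht, ite_pow, hss]
    split_ifs with hk
    · rw [prod_eq_exp_sum_log hp, hc, ← Real.exp_nat_mul, ← Real.exp_neg]
      have h2 := (Finset.mem_filter.1 hk).2
      simp only [neg_sub, sub_neg_eq_add, Finset.sum_add_distrib, Finset.sum_const,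
        Finset.card_univ, Fintype.card_fin, nsmul_eq_mul] at h2
      exact Real.exp_le_exp.2 (by linarith)
    · simpa using hcpos.le
  refine le_iInf₂ fun σ ⟨hσ, hdist⟩ => ?_
  refine le_trans (ENNReal.ofReal_le_ofReal ?_) (expect_le_mul_extent hcpos
    (norm_inner_schmidtVec_prodVec_sq_le hU hW hcpos.le htc) σ)
  rw [hψ] at hdist
  have h1 := abs_expect_le ((isHermitian_proj (schmidtVec s U W)).sub hσ.1.1) (schmidtVec t U W)
  rw [norm_schmidtVec_sq hU hW, hsum_t, expect_sub, expect_proj, inner_schmidtVec hU hW, hsum_ts,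
    Complex.norm_real, Real.norm_eq_abs, sq_abs] at h1
  have h2 := (abs_le.1 h1).2
  have h3 : traceNorm (proj (schmidtVec s U W) - σ) * q ≤ 1 / 4 * q :=
    mul_le_mul_of_nonneg_right (by linarith) (by linarith)
  -- The state itself has expectation `q²`, and passing to `σ` loses at most `2ε‖t‖² ≤ q/4`; then `q
  -- (q - 1/4) ≥ 1/8` since `q > 1/2`.
  have h4 : 1 / 8 ≤ expect (schmidtVec t U W) σ := by nlinarith
  rw [hc, div_inv_eq_mul]
  exact mul_le_mul_of_nonneg_right h4 (by positivity)

/-- The asymptotic extent of a pure state is the exponential of its entanglement entropy. -/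
lemma liminfSmoothedExtent_eq (hu : Orthonormal ℂ u) (hw : Orthonormal ℂ w)
    (hp : ∀ k, 0 < p k) (hp1 : ∑ k, p k = 1) {ε : ℝ} (hε : 0 < ε) (hε' : ε < 1 / 8) :
    liminfSmoothedExtent (proj (schmidtVec (fun k => √(p k)) u w)) ε =
      ENNReal.ofReal (Real.exp (∑ k, Real.negMulLog (p k))) := by
  set H := ∑ k, Real.negMulLog (p k) with hH
  have hroot : ∀ {x y : ℝ≥0∞} {n : ℕ}, x ≤ y → x ^ (1 / (n : ℝ)) ≤ y ^ (1 / (n : ℝ)) :=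
    fun h => ENNReal.rpow_le_rpow h (by positivity)
  have hcont : ∀ f : ℝ → ℝ, Continuous f → f 0 = H →
      Tendsto (fun δ => ENNReal.ofReal (Real.exp (f δ))) (𝓝[>] 0)
        (𝓝 (ENNReal.ofReal (Real.exp H))) := fun f hf h0 => by
    have h : Continuous fun δ => ENNReal.ofReal (Real.exp (f δ)) :=
      ENNReal.continuous_ofReal.comp (Real.continuous_exp.comp hf)
    simpa [h0] using (h.tendsto 0).mono_left nhdsWithin_le_nhds
  -- For fixed `ε`, the liminf lies between `e^{H-δ}` and `e^{H+δ}` for every `δ > 0`; only `δ`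
  -- tends to 0 here.
  refine le_antisymm ?_ ?_
  · refine ge_of_tendsto (hcont (fun δ => H + δ) (by fun_prop) (by simp)) ?_
    filter_upwards [self_mem_nhdsWithin] with δ hδ
    rw [← (tendsto_ofReal_mul_pow_rpow (C := 8) (by norm_num)
      (Real.exp_pos (H + δ))).liminf_eq]
    exact liminf_le_liminf
      ((eventually_smoothedExtent_le hu hw hp hp1 hε hδ).mono fun n hn => hroot hn)
  · refine le_of_tendsto (hcont (fun δ => H - δ) (by fun_prop) (by simp)) ?_
    filter_upwards [self_mem_nhdsWithin] with δ hδ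
    rw [← (tendsto_ofReal_mul_pow_rpow (C := 1 / 8) (by norm_num)
      (Real.exp_pos (H - δ))).liminf_eq]
    exact liminf_le_liminf
      ((eventually_le_smoothedExtent hu hw hp hp1 hε' hδ).mono fun n hn => hroot hn)

end Copies

/-! ### The Schmidt decomposition -/

section Schmidt

variable {A B : Type*} [Fintype A] [Fintype B]

omit [Fintype A] in
lemma partialTraceB_proj (ψ : EuclideanSpace ℂ (A × B)) :
    partialTraceB (proj ψ) = ∑ b, proj (WithLp.toLp 2 fun a => ψ (a, b)) := by
  ext i j
  simp [partialTraceB, proj_apply, Matrix.sum_apply]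

lemma posSemidef_partialTraceB_proj (ψ : EuclideanSpace ℂ (A × B)) :
    (partialTraceB (proj ψ)).PosSemidef := by
  rw [partialTraceB_proj]
  exact Matrix.posSemidef_sum _ fun b _ => Matrix.posSemidef_vecMulVec_self_star _

lemma trace_partialTraceB_proj (ψ : EuclideanSpace ℂ (A × B)) :
    (partialTraceB (proj ψ)).trace = ((‖ψ‖ ^ 2 : ℝ) : ℂ) := by
  rw [← trace_proj]
  simp [partialTraceB, Matrix.trace, Fintype.sum_prod_type]

/-- Expanding `ψ` along an eigenbasis `e` of `ρ_A` gives `∑ e k ⊗ v k` with the `v k` orthogonal and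
`‖v k‖²` the eigenvalues. Zero eigenvalues are dropped so that the `v k` can be normalized and all
`p k` are positive; the last clause, valid for `f 0 = 0`, reads entropies and purity off `p`. -/
lemma exists_schmidt_decomposition {A : Type u} {B : Type v} [Fintype A] [Fintype B]
    [DecidableEq A] {ψ : EuclideanSpace ℂ (A × B)} (hψ : ‖ψ‖ = 1) :
    ∃ (K : Type u) (_ : Fintype K) (p : K → ℝ) (u : K → EuclideanSpace ℂ A)
      (w : K → EuclideanSpace ℂ B), (∀ k, 0 < p k) ∧ ∑ k, p k = 1 ∧ Orthonormal ℂ u ∧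
      Orthonormal ℂ w ∧ ψ = schmidtVec (fun k => √(p k)) u w ∧
      ∀ f : ℝ → ℝ, f 0 = 0 → (cfc f (partialTraceB (proj ψ))).trace.re = ∑ k, f (p k) := by
  classical
  have hρ := posSemidef_partialTraceB_proj ψ
  set e := hρ.1.eigenvectorBasis with he
  set l := hρ.1.eigenvalues with hl
  have hl0 : ∀ k, 0 ≤ l k := hρ.eigenvalues_nonneg
  set c : B → EuclideanSpace ℂ A := fun b => WithLp.toLp 2 fun a => ψ (a, b) with hc
  set v : A → EuclideanSpace ℂ B := fun k => WithLp.toLp 2 fun b => inner ℂ (e k) (c b) with hv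
  have hvv : ∀ k m, inner ℂ (v k) (v m) = if k = m then (l k : ℂ) else 0 := by
    intro k m
    -- The indices swap: `⟨v k, v m⟩ = ∑ b, ⟨e m, c b⟩⟨c b, e k⟩ = ⟨e m|ρ_A|e k⟩`.
    have h1 : star (e m).ofLp ⬝ᵥ (partialTraceB (proj ψ) *ᵥ (e k).ofLp) =
        inner ℂ (v k) (v m) := by
      rw [partialTraceB_proj, Matrix.sum_mulVec, dotProduct_sum]
      simp only [PiLp.inner_apply, hv, RCLike.inner_apply]
      refine Finset.sum_congr rfl fun b _ => ?_
      rw [map_sum, Finset.sum_mul_sum]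
      simp only [dotProduct, Matrix.mulVec, proj_apply, Finset.mul_sum, map_mul,
        Complex.conj_conj, Pi.star_apply, Complex.star_def, hc]
      refine Finset.sum_congr rfl fun i _ => Finset.sum_congr rfl fun j _ => ?_
      ring
    rw [← h1, hρ.1.mulVec_eigenvectorBasis, dotProduct_smul, dotProduct_comm,
      ← EuclideanSpace.inner_eq_star_dotProduct, orthonormal_iff_ite.1 e.orthonormal]
    by_cases h : k = m
    · simp [h, hl]
    · simp [h, Ne.symm h]
  have hψ' : ∀ a b, ψ (a, b) = ∑ k, e k a * v k b := by
    intro a b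
    have h := congrArg (fun z : EuclideanSpace ℂ A => z a) (e.sum_repr' (c b))
    simp only [WithLp.ofLp_sum, Finset.sum_apply, PiLp.smul_apply, smul_eq_mul] at h
    rw [show ψ (a, b) = c b a from rfl, ← h]
    exact Finset.sum_congr rfl fun k _ => mul_comm _ _
  have hsub : ∀ {M : Type} [AddCommMonoid M] (g : A → M), (∀ k, l k = 0 → g k = 0) →
      ∑ k : {k // 0 < l k}, g k = ∑ k, g k := by
    intro M _ g hg
    rw [← Finset.sum_subtype (Finset.univ.filter fun k => 0 < l k) (by simp) g]
    refine Finset.sum_filter_of_ne fun k _ hk => ?_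
    exact (hl0 k).lt_of_ne fun h => hk (hg k h.symm)
  have hf : ∀ f : ℝ → ℝ, f 0 = 0 →
      (cfc f (partialTraceB (proj ψ))).trace.re = ∑ k : {k // 0 < l k}, f (l k) := by
    intro f hf
    rw [trace_cfc hρ.1, hsub (fun k => f (l k)) fun k hk => by rw [hk, hf]]
    simp [hl]
  refine ⟨{k // 0 < l k}, inferInstance, fun k => l k, fun k => e k,
    fun k => ((√(l k))⁻¹ : ℂ) • v k, fun k => k.2, ?_,
    e.orthonormal.comp _ Subtype.val_injective, ?_, ?_, hf⟩
  · have h := congrArg Complex.re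
      (hρ.1.trace_eq_sum_eigenvalues.symm.trans (trace_partialTraceB_proj ψ))
    simp only [Complex.coe_algebraMap, Complex.re_sum, Complex.ofReal_re, hψ, one_pow] at h
    rw [← h]
    exact hsub l fun k hk => hk
  · rw [orthonormal_iff_ite]
    intro k m
    rw [inner_smul_left, inner_smul_right, hvv]
    by_cases h : k = m
    · subst h
      have h1 : (√(l k) : ℂ) * (√(l k) : ℂ) = (l k : ℂ) := by
        exact_mod_cast Real.mul_self_sqrt (hl0 k)
      have h2 : (√(l k) : ℂ) ≠ 0 := by
        exact_mod_cast (Real.sqrt_pos.2 k.2).ne'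
      simp only [if_true, map_inv₀, Complex.conj_ofReal, ← h1]
      field_simp
    · simp [h, Subtype.val_injective.ne h]
  · ext ⟨a, b⟩
    rw [hψ', schmidtVec_apply, ← hsub fun k => e k a * v k b]
    · refine Finset.sum_congr rfl fun k _ => ?_
      have h2 : (√(l k) : ℂ) ≠ 0 := by
        exact_mod_cast (Real.sqrt_pos.2 k.2).ne'
      simp only [PiLp.smul_apply, smul_eq_mul]
      field_simp
    · intro k hk
      have h := hvv k k
      rw [if_pos rfl, hk, Complex.ofReal_zero, inner_self_eq_zero] at h
      simp [h]

end Schmidt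

/-! ### Entropies -/

section Entropy

lemma log2_ofReal {x : ℝ} (hx : 0 < x) :
    log2 (ENNReal.ofReal x) = ((Real.log x / Real.log 2 : ℝ) : EReal) := by
  rw [log2, ENNReal.log_ofReal_of_pos hx, EReal.coe_div]

variable {K : Type*} [Fintype K] {p : K → ℝ}

/-- The Shannon entropy is strictly smaller than the Rényi entropy of order `1/2`, unless the
distribution is uniform. -/
lemma exp_entropy_lt_sq_sum_sqrt (hp : ∀ k, 0 < p k) (hp1 : ∑ k, p k = 1)
    (hne : ∀ r : ℕ, r * ∑ k, p k ^ 2 ≠ 1) :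
    Real.exp (∑ k, Real.negMulLog (p k)) < (∑ k, √(p k)) ^ 2 := by
  obtain ⟨j, k, hjk⟩ : ∃ j k, p j ≠ p k := by
    by_contra! h
    rcases isEmpty_or_nonempty K with hK | ⟨⟨k₀⟩⟩
    · simp at hp1
    · have h1 : ∀ k, p k = p k₀ := fun k => h k k₀
      apply hne (Fintype.card K)
      simp only [h1, Finset.sum_const, Finset.card_univ, nsmul_eq_mul] at hp1 ⊢
      calc (Fintype.card K : ℝ) * (Fintype.card K * p k₀ ^ 2) = (Fintype.card K * p k₀) ^ 2 := by
            ring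
        _ = 1 := by rw [hp1, one_pow]
  have hs : ∀ k, 0 < √(p k) := fun k => Real.sqrt_pos.2 (hp k)
  -- Jensen for `log` at the points `p^{-1/2}` with weights `p`: the mean of the logarithms is
  -- `H/2`, and the mean of the points is `∑ √p`.
  have hJ := strictConcaveOn_log_Ioi.lt_map_sum (t := Finset.univ) (w := p)
    (p := fun k => (√(p k))⁻¹) (fun k _ => hp k) hp1 (fun k _ => inv_pos.2 (hs k))
    ⟨j, Finset.mem_univ _, k, Finset.mem_univ _, fun h => hjk <| by
      rw [← Real.sq_sqrt (hp j).le, ← Real.sq_sqrt (hp k).le, inv_injective h]⟩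
  have h1 : ∑ k, p k • Real.log (√(p k))⁻¹ = (∑ k, Real.negMulLog (p k)) / 2 := by
    rw [Finset.sum_div]
    refine Finset.sum_congr rfl fun k _ => ?_
    rw [Real.log_inv, Real.log_sqrt (hp k).le, Real.negMulLog, smul_eq_mul]
    ring
  have h2 : ∑ k, p k • (√(p k))⁻¹ = ∑ k, √(p k) :=
    Finset.sum_congr rfl fun k _ => by
      rw [smul_eq_mul, ← div_eq_mul_inv, Real.div_sqrt]
  rw [h1, h2] at hJ
  have hpos : 0 < ∑ k, √(p k) :=
    Finset.sum_pos (fun k _ => hs k) ⟨j, Finset.mem_univ _⟩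
  rw [← Real.lt_log_iff_exp_lt (by positivity), Real.log_pow]
  push_cast
  linarith

end Entropy

/-! ### Generic vectors do not have a flat Schmidt spectrum -/

section Generic

/-- Fubini: each line in direction `v` meets the zero set in finitely many points. -/
lemma ae_ne_zero_of_polynomial_on_lines {E : Type*} [NormedAddCommGroup E] [NormedSpace ℝ E]
    [FiniteDimensional ℝ E] [MeasurableSpace E] [BorelSpace E] (μ : Measure E)
    [μ.IsAddHaarMeasure] {F : E → ℝ} (hF : Continuous F) (v : E)
    (h : ∀ x, ∃ P : Polynomial ℝ, P ≠ 0 ∧ ∀ t : ℝ, F (x + t • v) = P.eval t) :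
    ∀ᵐ x ∂μ, F x ≠ 0 := by
  refine ae_mem_of_ae_add_linearMap_mem (LinearMap.toSpanSingleton ℝ E v) volume μ
    (s := {x | F x ≠ 0}) (isOpen_ne_fun hF continuous_const).measurableSet fun x => ?_
  obtain ⟨P, hP, hPF⟩ := h x
  have hfin : {t : ℝ | P.eval t = 0}.Finite :=
    (P.roots.toFinset.finite_toSet).subset fun t ht => by
      simpa [hP] using ht
  filter_upwards [compl_mem_ae_iff.2 (hfin.measure_zero volume)] with t ht
  simpa [hPF] using ht

/-- The surface measure of a set is a multiple of the volume of the cone over it, and by homogeneity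
the cone over zeros consists of zeros. -/
lemma ae_toSphere_ne_zero {E : Type*} [NormedAddCommGroup E] [NormedSpace ℝ E]
    [FiniteDimensional ℝ E] [MeasurableSpace E] [BorelSpace E] (μ : Measure E)
    [μ.IsAddHaarMeasure] {F : E → ℝ} (hF : Continuous F) {d : ℕ}
    (hd : ∀ (t : ℝ) x, F (t • x) = t ^ d * F x) (h : ∀ᵐ x ∂μ, F x ≠ 0) :
    ∀ᵐ x ∂μ.toSphere, F x.1 ≠ 0 := by
  have hm : MeasurableSet {x : Metric.sphere (0 : E) 1 | F x.1 = 0} :=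
    (isClosed_eq (hF.comp continuous_subtype_val) continuous_const).measurableSet
  rw [ae_iff]
  simp only [ne_eq, not_not]
  rw [Measure.toSphere_apply' _ hm]
  refine mul_eq_zero_of_right _ (measure_mono_null ?_ (ae_iff.1 h))
  rintro _ ⟨t, -, _, ⟨y, hy, rfl⟩, rfl⟩
  have hy : F y.1 = 0 := hy
  simp [hd, hy]

variable {A B : Type*} [Fintype A] [Fintype B]

/-- A quartic form vanishing at the unit vectors with flat Schmidt spectrum of rank `r`. -/
def flatForm (r : ℝ) (ψ : EuclideanSpace ℂ (A × B)) : ℝ :=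
  r * (partialTraceB (proj ψ) * partialTraceB (proj ψ)).trace.re -
    (partialTraceB (proj ψ)).trace.re ^ 2

lemma continuous_flatForm (r : ℝ) : Continuous (flatForm (A := A) (B := B) r) := by
  have h : Continuous fun ψ : EuclideanSpace ℂ (A × B) => partialTraceB (proj ψ) := by
    refine continuous_matrix fun i j => ?_
    simp only [partialTraceB, proj_apply, Matrix.of_apply]
    fun_prop
  have h1 := Complex.continuous_re.comp (h.matrix_mul h).matrix_trace
  have h2 := Complex.continuous_re.comp h.matrix_trace
  exact (continuous_const.mul h1).sub (h2.pow 2)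

omit [Fintype A] in
lemma partialTraceB_proj_add_smul (x v : EuclideanSpace ℂ (A × B)) :
    ∃ C : Matrix A A ℂ, ∀ t : ℝ, partialTraceB (proj (x + t • v)) =
      partialTraceB (proj x) + t • C + t ^ 2 • partialTraceB (proj v) := by
  refine ⟨Matrix.of fun i j => ∑ b, (x (i, b) * star (v (j, b)) + v (i, b) * star (x (j, b))),
    fun t => ?_⟩
  ext i j
  simp only [partialTraceB, proj_apply, Matrix.of_apply, Matrix.add_apply, Matrix.smul_apply,
    PiLp.add_apply, PiLp.smul_apply, Finset.smul_sum, ← Finset.sum_add_distrib,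
    Complex.real_smul, star_add, star_mul', Complex.star_def, Complex.conj_ofReal]
  refine Finset.sum_congr rfl fun b _ => ?_
  push_cast
  ring

lemma flatForm_smul (r t : ℝ) (ψ : EuclideanSpace ℂ (A × B)) :
    flatForm r (t • ψ) = t ^ 4 * flatForm r ψ := by
  have h : partialTraceB (proj (t • ψ)) = t ^ 2 • partialTraceB (proj ψ) := by
    ext i j
    simp only [partialTraceB, proj_apply, Matrix.of_apply, Matrix.smul_apply, PiLp.smul_apply,
      Finset.smul_sum, Complex.real_smul, star_mul', Complex.star_def, Complex.conj_ofReal]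
    refine Finset.sum_congr rfl fun b _ => ?_
    push_cast
    ring
  simp only [flatForm, h, Matrix.smul_mul, Matrix.mul_smul, Matrix.trace_smul, Complex.smul_re,
    smul_eq_mul]
  ring

-- The coefficient of `t⁴` is `flatForm r v`, independent of `x`, so one direction `v` serves every
-- line.
open Polynomial in
lemma flatForm_add_smul {r : ℝ} {v : EuclideanSpace ℂ (A × B)} (hv : flatForm r v ≠ 0)
    (x : EuclideanSpace ℂ (A × B)) :
    ∃ P : ℝ[X], P ≠ 0 ∧ ∀ t : ℝ, flatForm r (x + t • v) = P.eval t := by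
  obtain ⟨D, hD⟩ := partialTraceB_proj_add_smul x v
  have hc : ∀ c₄ c₃ c₂ c₁ c₀ : ℝ,
      (C c₄ * X ^ 4 + C c₃ * X ^ 3 + C c₂ * X ^ 2 + C c₁ * X + C c₀).coeff 4 = c₄ := by
    intros
    simp
  set R := partialTraceB (proj x)
  set V := partialTraceB (proj v) with hV
  refine ⟨C (flatForm r v) * X ^ 4 +
    C (r * ((D * V).trace.re + (V * D).trace.re) - 2 * D.trace.re * V.trace.re) * X ^ 3 +
    C (r * ((R * V).trace.re + (D * D).trace.re + (V * R).trace.re) -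
      (2 * R.trace.re * V.trace.re + D.trace.re ^ 2)) * X ^ 2 +
    C (r * ((R * D).trace.re + (D * R).trace.re) - 2 * R.trace.re * D.trace.re) * X +
    C (r * (R * R).trace.re - R.trace.re ^ 2), fun h => hv ?_, fun t => ?_⟩
  · rw [← hc (flatForm r v), h, coeff_zero]
  · simp only [flatForm, hD, ← hV, Matrix.add_mul, Matrix.mul_add, Matrix.smul_mul,
      Matrix.mul_smul, Matrix.trace_add, Matrix.trace_smul, Complex.add_re, Complex.smul_re,
      smul_eq_mul, eval_add, eval_mul, eval_C, eval_X, eval_pow]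
    ring

/-- A product basis vector gives `r - 1`. For `r = 1` a flat vector of Schmidt rank two gives `2 -
4`; this is where both dimensions must be at least 2. -/
lemma exists_flatForm_ne_zero (hA : 2 ≤ Fintype.card A) (hB : 2 ≤ Fintype.card B) (r : ℝ) :
    ∃ v : EuclideanSpace ℂ (A × B), flatForm r v ≠ 0 := by
  classical
  obtain ⟨a, a', haa⟩ := Fintype.exists_pair_of_one_lt_card hA
  obtain ⟨b, b', hbb⟩ := Fintype.exists_pair_of_one_lt_card hB
  by_cases hr : r = 1
  · refine ⟨WithLp.toLp 2 fun i => if i = (a, b) ∨ i = (a', b') then 1 else 0, ?_⟩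
    have h : partialTraceB (proj (WithLp.toLp 2 fun i : A × B =>
        if i = (a, b) ∨ i = (a', b') then (1 : ℂ) else 0)) =
        Matrix.diagonal fun i => if i = a ∨ i = a' then (1 : ℂ) else 0 := by
      ext i j
      simp only [partialTraceB, proj_apply, Matrix.of_apply, Matrix.diagonal_apply, Prod.mk.injEq]
      by_cases hi : i = a
      · subst hi
        by_cases hj : i = j
        · subst hj
          simp [haa]
        · by_cases hj' : j = a'
          · subst hj'
            simp [haa, Ne.symm haa, Ne.symm hbb]
          · simp [hj, Ne.symm hj, hj']
      · by_cases hi' : i = a'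
        · subst hi'
          by_cases hj : i = j
          · subst hj
            simp [Ne.symm haa]
          · by_cases hj' : j = a
            · subst hj'
              simp [haa, Ne.symm haa, hbb]
            · simp [hj, Ne.symm hj, hj']
        · simp [hi, hi']
    have hsum : ∑ i, (if i = a ∨ i = a' then (1 : ℂ) else 0) = 2 := by
      rw [Finset.sum_boole, show (Finset.univ.filter fun i => i = a ∨ i = a') = {a, a'} by
        ext; simp, Finset.card_pair haa]
      rfl
    simp only [flatForm, h, Matrix.diagonal_mul_diagonal, Matrix.trace_diagonal, mul_ite, mul_one,
      mul_zero, ← ite_and, and_self, hsum, hr]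
    norm_num
  · refine ⟨WithLp.toLp 2 fun i => if i = (a, b) then 1 else 0, ?_⟩
    have h : partialTraceB (proj (WithLp.toLp 2 fun i : A × B =>
        if i = (a, b) then (1 : ℂ) else 0)) =
        Matrix.diagonal fun i => if i = a then (1 : ℂ) else 0 := by
      ext i j
      simp only [partialTraceB, proj_apply, Matrix.of_apply, Matrix.diagonal_apply, Prod.mk.injEq]
      by_cases hi : i = a
      · subst hi
        by_cases hj : i = j
        · subst hj
          simp
        · simp [hj, Ne.symm hj]
      · simp [hi]
    simp only [flatForm, h, Matrix.diagonal_mul_diagonal, Matrix.trace_diagonal]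
    simpa [sub_eq_zero] using hr

lemma ae_toSphere_flatForm_ne_zero (hA : 2 ≤ Fintype.card A) (hB : 2 ≤ Fintype.card B) (r : ℝ) :
    ∀ᵐ ψ ∂(volume : Measure (EuclideanSpace ℂ (A × B))).toSphere, flatForm r ψ.1 ≠ 0 := by
  obtain ⟨v, hv⟩ := exists_flatForm_ne_zero hA hB r
  exact ae_toSphere_ne_zero volume (continuous_flatForm r) (flatForm_smul r)
    (ae_ne_zero_of_polynomial_on_lines volume (continuous_flatForm r) v (flatForm_add_smul hv))

end Generic

/-! ### The main theorem -/

section Main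

variable {A B : Type*} [Fintype A] [Fintype B] [DecidableEq A] [DecidableEq B]

omit [DecidableEq B] in
lemma purity_eq_trace_cfc {ψ : EuclideanSpace ℂ (A × B)} :
    (partialTraceB (proj ψ) * partialTraceB (proj ψ)).trace.re =
      (cfc (fun x : ℝ => x ^ 2) (partialTraceB (proj ψ))).trace.re := by
  have h := cfc_pow_id (R := ℝ) (partialTraceB (proj ψ)) 2
    (ha := (posSemidef_partialTraceB_proj ψ).1)
  rw [h, sq]

/-- Both limits exist, and are given by the entropies of the reduced state. -/
lemma extents_of_unit_vector {ψ : EuclideanSpace ℂ (A × B)} (hψ : ‖ψ‖ = 1) :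
    (Tendsto (liminfSmoothedExtent (proj ψ)) (𝓝[>] 0) (𝓝 (asymptoticExtent (proj ψ))) ∧
      log2 (asymptoticExtent (proj ψ)) = (vonNeumannEntropy (partialTraceB (proj ψ)) : EReal) ∧
      Tendsto (extentPerCopy (proj ψ)) atTop (𝓝 (regularizedExtent (proj ψ))) ∧
      log2 (regularizedExtent (proj ψ)) =
        (renyiEntropy (1 / 2) (partialTraceB (proj ψ)) : EReal)) ∧
    ((∀ r : ℕ, flatForm r ψ ≠ 0) →
      asymptoticExtent (proj ψ) < regularizedExtent (proj ψ)) := by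
  obtain ⟨⟨a₀, b₀⟩⟩ : Nonempty (A × B) := by
    by_contra h
    rw [not_nonempty_iff] at h
    simp [Subsingleton.elim ψ 0] at hψ
  have : Nonempty A := ⟨a₀⟩
  have : Nonempty B := ⟨b₀⟩
  obtain ⟨K, _, p, u, w, hp, hp1, hu, hw, hψp, hf⟩ := exists_schmidt_decomposition hψ
  have hs : 0 < ∑ k, √(p k) := by
    refine Finset.sum_pos (fun k _ => Real.sqrt_pos.2 (hp k)) ?_
    by_contra h
    rw [Finset.not_nonempty_iff_eq_empty] at h
    simp [h] at hp1
  have hlim1 : Tendsto (liminfSmoothedExtent (proj ψ)) (𝓝[>] 0)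
      (𝓝 (ENNReal.ofReal (Real.exp (∑ k, Real.negMulLog (p k))))) := by
    refine tendsto_const_nhds.congr' ?_
    filter_upwards [Ioo_mem_nhdsGT (show (0 : ℝ) < 1 / 8 by norm_num)] with ε hε
    rw [hψp]
    exact (liminfSmoothedExtent_eq hu hw hp hp1 hε.1 hε.2).symm
  have hlim2 : Tendsto (extentPerCopy (proj ψ)) atTop
      (𝓝 (ENNReal.ofReal ((∑ k, √(p k)) ^ 2))) := by
    rw [hψp]
    exact tendsto_extentPerCopy hu hw (fun k => Real.sqrt_nonneg _) hs
  have h1 : asymptoticExtent (proj ψ) = _ := hlim1.limUnder_eq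
  have h2 : regularizedExtent (proj ψ) = _ := hlim2.limUnder_eq
  rw [h1, h2, log2_ofReal (Real.exp_pos _), log2_ofReal (by positivity), vonNeumannEntropy,
    renyiEntropy, hf _ (by simp), hf _ (by simp)]
  refine ⟨⟨hlim1, ?_, hlim2, ?_⟩, fun hr => ?_⟩
  · rw [Real.log_exp, Finset.sum_div]
    congr 1
    refine Finset.sum_congr rfl fun k _ => ?_
    rw [Real.negMulLog, Real.logb]
    ring
  · rw [Real.log_pow]
    simp only [Real.sqrt_eq_rpow, Real.logb]
    congr 1
    push_cast
    ring
  · refine (ENNReal.ofReal_lt_ofReal_iff (by positivity)).2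
      (exp_entropy_lt_sq_sum_sqrt hp hp1 fun r h => hr r ?_)
    -- On unit vectors the form equals `r ∑ p² - 1`, so its nonvanishing excludes uniform `p`.
    rw [flatForm, purity_eq_trace_cfc, hf _ (by simp), h, trace_partialTraceB_proj, hψ]
    simp

end Main

end QuasiprobabilityExtent

end

theorem mainTheorem4 {A B : Type*} [Fintype A] [DecidableEq A] [Fintype B] [DecidableEq B] :
    (∀ ψ : Metric.sphere (0 : EuclideanSpace ℂ (A × B)) 1,
      Tendsto (liminfSmoothedExtent (proj ψ.1)) (𝓝[>] 0) (𝓝 (asymptoticExtent (proj ψ.1))) ∧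
      log2 (asymptoticExtent (proj ψ.1)) =
        (vonNeumannEntropy (partialTraceB (proj ψ.1)) : EReal) ∧
      Tendsto (extentPerCopy (proj ψ.1)) atTop (𝓝 (regularizedExtent (proj ψ.1))) ∧
      log2 (regularizedExtent (proj ψ.1)) =
        (renyiEntropy (1 / 2) (partialTraceB (proj ψ.1)) : EReal)) ∧
    (2 ≤ Fintype.card A → 2 ≤ Fintype.card B →
      ∀ᵐ ψ ∂(volume : Measure (EuclideanSpace ℂ (A × B))).toSphere,
        asymptoticExtent (proj ψ.1) < regularizedExtent (proj ψ.1)) := by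
  refine ⟨fun ψ => (extents_of_unit_vector (mem_sphere_zero_iff_norm.1 ψ.2)).1, fun hA hB => ?_⟩
  -- Ranks are natural numbers, so the exceptional set is a countable union of null sets.
  filter_upwards [ae_all_iff.2 fun r : ℕ => ae_toSphere_flatForm_ne_zero hA hB (r : ℝ)] with ψ hψ
  exact (extents_of_unit_vector (mem_sphere_zero_iff_norm.1 ψ.2)).2 hψ
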